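/- Let $k$ be a field of characteristic $0$, let $n\ge 0$, and let $A=A_n(k)=k\langle x_1,\dots,x_n,\partial_1,\dots,\partial_n\rangle$ be the Weyl algebra, with the Bernstein filtration $F_i=\operatorname{span}_k\{x^{\mathbf a}\partial^{\mathbf b} : |\mathbf a|+|\mathbf b|\le i\}$ and the (commutative) associated graded ring $\operatorname{gr}A=\bigoplus_{i\ge 0}F_i/F_{i-1}$ (with $F_{-1}=0$); write $\bar x_i,\bar\partial_i\in F_1/F_0$ for the classes of $x_i,\partial_i$. For $F\subseteq[n]=\{1,\dots,n\}$ let $Q_F=(\bar x_i \mid i\notin F)+(\bar\partial_j\mid j\in F)\subseteq\operatorname{gr}A$. For a left $A$-module $M$ and $\mathbf a\in\mathbb Z^n$ let $M_{\mathbf a}=\{y\in M : (x_i\partial_i)y=a_iy \text{ for all } i\}$, and let $M_{\rm rat}=\bigoplus_{\mathbf a\in\mathbb Z^n}M_{\mathbf a}$, an $A$-submodule of $M$. For $F\subseteq[n]$ write $M_{F-\mathbf 1}=M_{\mathbf a}$ with $a_i=0$ for $i\in F$ and $a_i=-1$ for $i\notin F$. A good filtration of a left $A$-module $N$ is an increasing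 exhaustive filtration $\Gamma_0\subseteq\Gamma_1\subseteq\cdots$ of $N$ by $k$-subspaces with $F_i\Gamma_j\subseteq\Gamma_{i+j}$ such that $\operatorname{gr}N=\bigoplus_{i\ge0}\Gamma_i/\Gamma_{i-1}$ (with $\Gamma_{-1}=0$) is a finitely generated $\operatorname{gr}A$-module. Given such a filtration, $\operatorname{SS}(N)$ denotes the set of minimal associated primes of $\operatorname{gr}N$, and for a prime $Q$ of $\operatorname{gr}A$, $e_Q(N)$ denotes the length of the $(\operatorname{gr}A)_Q$-module $(\operatorname{gr}N)_Q$. Let $M$ be a finitely generated left $A$-module. Then $M_{\rm rat}$ admits a good filtration, and for every good filtration of $M_{\rm rat}$ $$\operatorname{SS}(M_{\rm rat})=\{Q_F \mid F\subseteq[n],\ M_{F-\mathbf 1}\neq 0\},$$ and for every $F\subseteq[n]$ the ideal $Q_F$ is prime, $M_{F-\mathbf 1}$ is finite dimensional over $k$, and $$e_{Q_F}(M_{\rm rat})=\dim_k M_{F-\mathbf 1}.$$ -/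

import Mathlib

open scoped DirectSum

noncomputable section

/-! ### The Weyl algebra -/

/-- The defining relations of the Weyl algebra: generators `inl i` stand for `x_i`, generators
`inr i` for `∂_i`; the `x_i` commute, the `∂_i` commute, and `∂_i x_j - x_j ∂_i = δ_{ij}`. -/
inductive WeylAlgebra.Rel (k : Type*) [Field k] (n : ℕ) :
    FreeAlgebra k (Fin n ⊕ Fin n) → FreeAlgebra k (Fin n ⊕ Fin n) → Prop
  | x_comm (i j : Fin n) : WeylAlgebra.Rel k n
      (FreeAlgebra.ι k (Sum.inl i) * FreeAlgebra.ι k (Sum.inl j))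
      (FreeAlgebra.ι k (Sum.inl j) * FreeAlgebra.ι k (Sum.inl i))
  | d_comm (i j : Fin n) : WeylAlgebra.Rel k n
      (FreeAlgebra.ι k (Sum.inr i) * FreeAlgebra.ι k (Sum.inr j))
      (FreeAlgebra.ι k (Sum.inr j) * FreeAlgebra.ι k (Sum.inr i))
  | d_x (i j : Fin n) : WeylAlgebra.Rel k n
      (FreeAlgebra.ι k (Sum.inr i) * FreeAlgebra.ι k (Sum.inl j))
      (FreeAlgebra.ι k (Sum.inl j) * FreeAlgebra.ι k (Sum.inr i) + if i = j then 1 else 0)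

/-- The Weyl algebra `A_n(k) = k⟨x_1, …, x_n, ∂_1, …, ∂_n⟩`. -/
def WeylAlgebra (k : Type*) [Field k] (n : ℕ) : Type _ := RingQuot (WeylAlgebra.Rel k n)

namespace WeylAlgebra

section Basic

variable (k : Type*) [Field k] (n : ℕ)

instance : Ring (WeylAlgebra k n) := inferInstanceAs (Ring (RingQuot (WeylAlgebra.Rel k n)))

instance : Algebra k (WeylAlgebra k n) :=
  inferInstanceAs (Algebra k (RingQuot (WeylAlgebra.Rel k n)))

/-- The quotient map from the free algebra. -/
def mk : FreeAlgebra k (Fin n ⊕ Fin n) →ₐ[k] WeylAlgebra k n :=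
  RingQuot.mkAlgHom k (WeylAlgebra.Rel k n)

/-- The generator `x_i`. -/
def x (i : Fin n) : WeylAlgebra k n := mk k n (FreeAlgebra.ι k (Sum.inl i))

/-- The generator `∂_i`. -/
def d (i : Fin n) : WeylAlgebra k n := mk k n (FreeAlgebra.ι k (Sum.inr i))

theorem mk_rel {a b : FreeAlgebra k (Fin n ⊕ Fin n)} (h : Rel k n a b) : mk k n a = mk k n b :=
  RingQuot.mkAlgHom_rel k h

theorem mk_surjective : Function.Surjective (mk k n) :=
  RingQuot.mkAlgHom_surjective k (Rel k n)

theorem x_mul_x (i j : Fin n) : x k n i * x k n j = x k n j * x k n i := by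
  simpa [x] using mk_rel k n (Rel.x_comm i j)

theorem d_mul_d (i j : Fin n) : d k n i * d k n j = d k n j * d k n i := by
  simpa [d] using mk_rel k n (Rel.d_comm i j)

theorem d_mul_x (i j : Fin n) :
    d k n i * x k n j = x k n j * d k n i + if i = j then 1 else 0 := by
  have h := mk_rel k n (Rel.d_x i j)
  split_ifs at h ⊢ <;> simpa [x, d] using h

/-- Induction on the generators. -/
theorem induction_on {P : WeylAlgebra k n → Prop} (a : WeylAlgebra k n)
    (hc : ∀ c : k, P (algebraMap k _ c)) (hx : ∀ i, P (x k n i)) (hd : ∀ i, P (d k n i))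
    (hmul : ∀ a b, P a → P b → P (a * b)) (hadd : ∀ a b, P a → P b → P (a + b)) : P a := by
  obtain ⟨b, rfl⟩ := mk_surjective k n a
  induction b using FreeAlgebra.induction with
  | grade0 r => simpa using hc r
  | grade1 s => rcases s with i | i; exacts [hx i, hd i]
  | mul a b ha hb => simpa using hmul _ _ ha hb
  | add a b ha hb => simpa using hadd _ _ ha hb

/-- The monomial `x^a = x_1^{a_1} ⋯ x_n^{a_n}`. -/
def xPow (a : Fin n → ℕ) : WeylAlgebra k n := ((List.finRange n).map fun i => x k n i ^ a i).prod

/-- The monomial `∂^b = ∂_1^{b_1} ⋯ ∂_n^{b_n}`. -/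
def dPow (b : Fin n → ℕ) : WeylAlgebra k n := ((List.finRange n).map fun i => d k n i ^ b i).prod

/-- The Bernstein filtration: `F_i` is the `k`-span of the `x^a ∂^b` with `|a| + |b| ≤ i`. -/
def bernstein (i : ℕ) : Submodule k (WeylAlgebra k n) :=
  Submodule.span k {m | ∃ a b : Fin n → ℕ, (∑ j, a j) + (∑ j, b j) ≤ i ∧
    m = xPow k n a * dPow k n b}

/-! ### Multiplicativity of the Bernstein filtration -/

theorem list_prod_add_single {R : Type*} [Monoid R] (f : Fin n → R)
    (hf : ∀ i j, f i * f j = f j * f i) (a : Fin n → ℕ) (i : Fin n) (l : List (Fin n))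
    (hl : l.Nodup) :
    (l.map fun j => f j ^ (a + Pi.single i 1 : Fin n → ℕ) j).prod =
      (if i ∈ l then f i else 1) * (l.map fun j => f j ^ a j).prod := by
  induction l with
  | nil => simp
  | cons j l ih =>
    rw [List.nodup_cons] at hl
    have ih := ih hl.2
    simp only [List.map_cons, List.prod_cons, ih]
    by_cases hij : i = j
    · subst hij
      simp [hl.1, pow_succ', mul_assoc]
    · have hc : f j ^ a j * f i = f i * f j ^ a j :=
        ((show Commute (f j) (f i) from hf j i).pow_left _).eq
      by_cases hi : i ∈ l <;> simp [hi, hij, ← mul_assoc, hc]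

theorem x_mul_xPow (i : Fin n) (a : Fin n → ℕ) :
    x k n i * xPow k n a = xPow k n (a + Pi.single i 1) := by
  have := list_prod_add_single n (x k n) (x_mul_x k n) a i _ (List.nodup_finRange n)
  simpa [xPow] using this.symm

theorem d_mul_dPow (i : Fin n) (a : Fin n → ℕ) :
    d k n i * dPow k n a = dPow k n (a + Pi.single i 1) := by
  have := list_prod_add_single n (d k n) (d_mul_d k n) a i _ (List.nodup_finRange n)
  simpa [dPow] using this.symm

theorem d_mul_x_pow (i : Fin n) (m : ℕ) :
    d k n i * x k n i ^ m = x k n i ^ m * d k n i + m • x k n i ^ (m - 1) := by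
  induction m with
  | zero => simp
  | succ m ih =>
    rw [pow_succ, ← mul_assoc, ih, add_mul, mul_assoc, d_mul_x, if_pos rfl]
    rcases m with _ | m
    · simp
    · simp only [Nat.add_sub_cancel, smul_mul_assoc, ← pow_succ]
      rw [mul_add, ← mul_assoc, ← pow_succ, mul_one, add_assoc, succ_nsmul' _ (m + 1)]

theorem d_mul_x_pow_of_ne {i j : Fin n} (h : i ≠ j) (m : ℕ) :
    d k n i * x k n j ^ m = x k n j ^ m * d k n i := by
  have : Commute (d k n i) (x k n j) := by
    rw [commute_iff_eq, d_mul_x, if_neg h, add_zero]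
  exact (this.pow_right m).eq

theorem d_mul_xPow_list (i : Fin n) (a : Fin n → ℕ) (l : List (Fin n)) (hl : l.Nodup) :
    d k n i * (l.map fun j => x k n j ^ a j).prod = (l.map fun j => x k n j ^ a j).prod * d k n i +
      if i ∈ l then a i • (l.map fun j => x k n j ^ (Function.update a i (a i - 1)) j).prod
        else 0 := by
  induction l with
  | nil => simp
  | cons j l ih =>
    rw [List.nodup_cons] at hl
    have ih := ih hl.2
    simp only [List.map_cons, List.prod_cons]
    by_cases hij : i = j
    · subst hij
      have hcongr : (l.map fun j => x k n j ^ (Function.update a i (a i - 1)) j) =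
          (l.map fun j => x k n j ^ a j) := by
        refine List.map_congr_left fun j hj => ?_
        rw [Function.update_of_ne]
        rintro rfl
        exact hl.1 hj
      rw [if_neg hl.1, add_zero] at ih
      simp only [List.mem_cons, true_or, if_true, Function.update_self, hcongr]
      rw [← mul_assoc, d_mul_x_pow, add_mul, mul_assoc, ih, smul_mul_assoc, mul_assoc]
    · rw [← mul_assoc, d_mul_x_pow_of_ne k n hij, mul_assoc, ih, mul_add, mul_assoc]
      congr 1
      by_cases hi : i ∈ l
      · simp only [hi, if_true, List.mem_cons, or_true, Function.update_of_ne (Ne.symm hij),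
          mul_smul_comm]
      · simp [hi, hij]

theorem d_mul_xPow (i : Fin n) (a : Fin n → ℕ) :
    d k n i * xPow k n a =
      xPow k n a * d k n i + a i • xPow k n (Function.update a i (a i - 1)) := by
  have := d_mul_xPow_list k n i a _ (List.nodup_finRange n)
  simpa [xPow] using this

/-- The span of `1`, the `x_i` and the `∂_i`. -/
def gens : Submodule k (WeylAlgebra k n) :=
  Submodule.span k ({1} ∪ (Set.range (x k n) ∪ Set.range (d k n)))

theorem one_mem_gens : (1 : WeylAlgebra k n) ∈ gens k n := Submodule.subset_span (by simp)

theorem x_mem_gens (i : Fin n) : x k n i ∈ gens k n := Submodule.subset_span (by simp)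

theorem d_mem_gens (i : Fin n) : d k n i ∈ gens k n := Submodule.subset_span (by simp)

theorem monomial_mem_bernstein {i : ℕ} (a b : Fin n → ℕ) (h : (∑ j, a j) + (∑ j, b j) ≤ i) :
    xPow k n a * dPow k n b ∈ bernstein k n i :=
  Submodule.subset_span ⟨a, b, h, rfl⟩

theorem bernstein_mono : Monotone (bernstein k n) := fun _ _ hij =>
  Submodule.span_mono fun _ ⟨a, b, h, e⟩ => ⟨a, b, h.trans hij, e⟩

theorem gens_mul_bernstein (i : ℕ) : gens k n * bernstein k n i ≤ bernstein k n (i + 1) := by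
  rw [gens, bernstein, Submodule.span_mul_span, Submodule.span_le]
  rintro _ ⟨v, hv, _, ⟨a, b, h, rfl⟩, rfl⟩
  have hsum : ∀ (c : Fin n → ℕ) (l : Fin n),
      ∑ j, (c + Pi.single l 1 : Fin n → ℕ) j = ∑ j, c j + 1 := by
    intro c l
    simp [Finset.sum_add_distrib]
  rcases hv with hv | ⟨l, rfl⟩ | ⟨l, rfl⟩
  · obtain rfl : v = 1 := hv
    simpa using monomial_mem_bernstein k n a b (h.trans (Nat.le_succ i))
  · change x k n l * (xPow k n a * dPow k n b) ∈ bernstein k n (i + 1)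
    rw [← mul_assoc, x_mul_xPow]
    refine monomial_mem_bernstein k n _ _ ?_
    rw [hsum]
    omega
  · change d k n l * (xPow k n a * dPow k n b) ∈ bernstein k n (i + 1)
    rw [← mul_assoc, d_mul_xPow, add_mul, mul_assoc, d_mul_dPow, smul_mul_assoc]
    refine add_mem (monomial_mem_bernstein k n _ _ ?_)
      (nsmul_mem (monomial_mem_bernstein k n _ _ ?_) _)
    · rw [hsum]
      omega
    · have : ∑ j, Function.update a l (a l - 1) j ≤ ∑ j, a j := by
        refine Finset.sum_le_sum fun j _ => ?_
        by_cases hj : j = l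
        · subst hj
          simp
        · simp [hj]
      omega

theorem gens_pow_mono : Monotone fun i : ℕ => gens k n ^ i := by
  refine monotone_nat_of_le_succ fun i => ?_
  intro a ha
  rw [pow_succ]
  simpa using Submodule.mul_mem_mul ha (one_mem_gens k n)

theorem list_prod_mem_gens_pow (f : Fin n → WeylAlgebra k n) (hf : ∀ i, f i ∈ gens k n)
    (a : Fin n → ℕ) (l : List (Fin n)) :
    (l.map fun j => f j ^ a j).prod ∈ gens k n ^ (l.map a).sum := by
  induction l with
  | nil => simpa using Submodule.one_le.mp (le_refl (1 : Submodule k (WeylAlgebra k n)))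
  | cons j l ih =>
    simp only [List.map_cons, List.prod_cons, List.sum_cons, pow_add]
    exact Submodule.mul_mem_mul (Submodule.pow_mem_pow _ (hf j) _) ih

/-- `F_i` is the `i`-th power of the span of `1`, the `x_i` and the `∂_i`. -/
theorem bernstein_eq_gens_pow (i : ℕ) : bernstein k n i = gens k n ^ i := by
  apply le_antisymm
  · rw [bernstein, Submodule.span_le]
    rintro _ ⟨a, b, h, rfl⟩
    refine gens_pow_mono k n h ?_
    change _ ∈ gens k n ^ _
    rw [pow_add]
    refine Submodule.mul_mem_mul ?_ ?_
    · have := list_prod_mem_gens_pow k n _ (x_mem_gens k n) a (List.finRange n)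
      rwa [← List.ofFn_eq_map, List.sum_ofFn] at this
    · have := list_prod_mem_gens_pow k n _ (d_mem_gens k n) b (List.finRange n)
      rwa [← List.ofFn_eq_map, List.sum_ofFn] at this
  · induction i with
    | zero =>
      rw [pow_zero, Submodule.one_le]
      simpa [xPow, dPow] using monomial_mem_bernstein k n (i := 0) 0 0 (by simp)
    | succ i ih =>
      rw [pow_succ']
      exact (mul_le_mul_right ih _).trans (gens_mul_bernstein k n i)

theorem one_mem_bernstein : (1 : WeylAlgebra k n) ∈ bernstein k n 0 := by
  rw [bernstein_eq_gens_pow, pow_zero]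
  exact Submodule.one_le.mp le_rfl

theorem x_mem_bernstein (i : Fin n) : x k n i ∈ bernstein k n 1 := by
  rw [bernstein_eq_gens_pow, pow_one]
  exact x_mem_gens k n i

theorem d_mem_bernstein (i : Fin n) : d k n i ∈ bernstein k n 1 := by
  rw [bernstein_eq_gens_pow, pow_one]
  exact d_mem_gens k n i

variable {k n} in
theorem mul_mem_bernstein {i j : ℕ} {a b : WeylAlgebra k n} (ha : a ∈ bernstein k n i)
    (hb : b ∈ bernstein k n j) : a * b ∈ bernstein k n (i + j) := by
  rw [bernstein_eq_gens_pow] at *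
  rw [pow_add]
  exact Submodule.mul_mem_mul ha hb

end Basic

end WeylAlgebra

/-! ### Associated graded objects of filtrations -/

/-- For a filtration `Γ_0 ⊆ Γ_1 ⊆ ⋯`, the preceding member `Γ_{i-1}`, with `Γ_{-1} = 0`. -/
def filtPrev {k E : Type*} [Field k] [AddCommGroup E] [Module k E] (Γ : ℕ → Submodule k E) :
    ℕ → Submodule k E
  | 0 => ⊥
  | i + 1 => Γ i

/-- The graded piece `Γ_i / Γ_{i-1}`. -/
def GrPiece {k E : Type*} [Field k] [AddCommGroup E] [Module k E] (Γ : ℕ → Submodule k E)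
    (i : ℕ) : Type _ :=
  Γ i ⧸ (filtPrev Γ i).submoduleOf (Γ i)

instance {k E : Type*} [Field k] [AddCommGroup E] [Module k E] (Γ : ℕ → Submodule k E) (i : ℕ) :
    AddCommGroup (GrPiece Γ i) :=
  inferInstanceAs (AddCommGroup (Γ i ⧸ (filtPrev Γ i).submoduleOf (Γ i)))

instance {k E : Type*} [Field k] [AddCommGroup E] [Module k E] (Γ : ℕ → Submodule k E) (i : ℕ) :
    Module k (GrPiece Γ i) :=
  inferInstanceAs (Module k (Γ i ⧸ (filtPrev Γ i).submoduleOf (Γ i)))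

/-- The class in `Γ_i / Γ_{i-1}` of an element of `Γ_i`. -/
def grMk {k E : Type*} [Field k] [AddCommGroup E] [Module k E] (Γ : ℕ → Submodule k E)
    (i : ℕ) (y : E) (hy : y ∈ Γ i) : GrPiece Γ i :=
  Submodule.Quotient.mk ⟨y, hy⟩

section Gr

variable {k E : Type*} [Field k] [AddCommGroup E] [Module k E] (Γ : ℕ → Submodule k E)

variable {Γ} in
theorem grMk_surj {i : ℕ} (q : GrPiece Γ i) : ∃ y, ∃ hy : y ∈ Γ i, grMk Γ i y hy = q := by
  obtain ⟨⟨y, hy⟩, rfl⟩ := Submodule.Quotient.mk_surjective _ q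
  exact ⟨y, hy, rfl⟩

theorem grMk_eq_iff {i : ℕ} {y z : E} (hy : y ∈ Γ i) (hz : z ∈ Γ i) :
    grMk Γ i y hy = grMk Γ i z hz ↔ y - z ∈ filtPrev Γ i := by
  exact Submodule.Quotient.eq ((filtPrev Γ i).submoduleOf (Γ i))

theorem grMk_add {i : ℕ} {y z : E} (hy : y ∈ Γ i) (hz : z ∈ Γ i) :
    grMk Γ i y hy + grMk Γ i z hz = grMk Γ i (y + z) (add_mem hy hz) := rfl

theorem grMk_zero (i : ℕ) : (0 : GrPiece Γ i) = grMk Γ i 0 (zero_mem _) := rfl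

theorem gradedMk_grMk_congr {i j : ℕ} (h : i = j) {y z : E} (hy : y ∈ Γ i) (hz : z ∈ Γ j)
    (hyz : y = z) :
    GradedMonoid.mk (A := GrPiece Γ) i (grMk Γ i y hy) = GradedMonoid.mk j (grMk Γ j z hz) := by
  subst h hyz
  rfl

end Gr

section GrMap

variable {k E E' E'' : Type*} [Field k] [AddCommGroup E] [Module k E] [AddCommGroup E']
  [Module k E'] [AddCommGroup E''] [Module k E''] {Γ : ℕ → Submodule k E}
  {Γ' : ℕ → Submodule k E'} {Γ'' : ℕ → Submodule k E''} (f : E →ₗ[k] E' →ₗ[k] E'')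


theorem map_filtPrev_left
    (hf : ∀ i j, ∀ a ∈ Γ i, ∀ b ∈ Γ' j, f a b ∈ Γ'' (i + j)) (i j : ℕ) : ∀ a ∈ filtPrev Γ i, ∀ b ∈ Γ' j,
    f a b ∈ filtPrev Γ'' (i + j) := by
  intro a ha b hb
  rcases i with _ | i
  · obtain rfl : a = 0 := ha
    simp
  · have : i + 1 + j = i + j + 1 := by omega
    rw [this]
    exact hf i j a ha b hb

theorem map_filtPrev_right
    (hf : ∀ i j, ∀ a ∈ Γ i, ∀ b ∈ Γ' j, f a b ∈ Γ'' (i + j)) (i j : ℕ) : ∀ a ∈ Γ i, ∀ b ∈ filtPrev Γ' j,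
    f a b ∈ filtPrev Γ'' (i + j) := by
  intro a ha b hb
  rcases j with _ | j
  · obtain rfl : b = 0 := hb
    simp
  · exact hf i j a ha b hb


variable (hf : ∀ i j, ∀ a ∈ Γ i, ∀ b ∈ Γ' j, f a b ∈ Γ'' (i + j))

/-- A bilinear map with `f (Γ_i, Γ'_j) ⊆ Γ''_{i+j}` induces bilinear maps
`Γ_i/Γ_{i-1} × Γ'_j/Γ'_{j-1} → Γ''_{i+j}/Γ''_{i+j-1}`. -/
def grMap₂ (i j : ℕ) : GrPiece Γ i →ₗ[k] GrPiece Γ' j →ₗ[k] GrPiece Γ'' (i + j) :=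
  Submodule.liftQ _
    { toFun := fun a => Submodule.mapQ _ _
        ((f a).restrict (p := Γ' j) (q := Γ'' (i + j)) fun b hb => hf i j a a.2 b hb)
        (fun b hb => map_filtPrev_right f hf i j a a.2 b hb)
      map_add' := fun a a' => by
        refine LinearMap.ext fun q => ?_
        obtain ⟨b, rfl⟩ := Submodule.Quotient.mk_surjective _ q
        refine congrArg Submodule.Quotient.mk (Subtype.ext ?_)
        exact LinearMap.map_add₂ f a a' b
      map_smul' := fun c a => by
        refine LinearMap.ext fun q => ?_
        obtain ⟨b, rfl⟩ := Submodule.Quotient.mk_surjective _ q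
        refine congrArg Submodule.Quotient.mk (Subtype.ext ?_)
        exact LinearMap.map_smul₂ f c a b }
    (fun a ha => by
      refine LinearMap.ext fun q => ?_
      obtain ⟨b, rfl⟩ := Submodule.Quotient.mk_surjective _ q
      refine (Submodule.Quotient.mk_eq_zero _).mpr ?_
      exact map_filtPrev_left f hf i j a ha b b.2)

theorem grMap₂_grMk {i j : ℕ} {a : E} {b : E'} (ha : a ∈ Γ i) (hb : b ∈ Γ' j) :
    grMap₂ f hf i j (grMk Γ i a ha) (grMk Γ' j b hb) =
      grMk Γ'' (i + j) (f a b) (hf i j a ha b hb) := rfl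

end GrMap

/-! ### The associated graded ring of the Weyl algebra -/

namespace WeylAlgebra

section GrRing

variable (k : Type*) [Field k] (n : ℕ)

/-- The multiplication `F_i/F_{i-1} × F_j/F_{j-1} → F_{i+j}/F_{i+j-1}` induced by that of `A`. -/
instance : GradedMonoid.GMul (GrPiece (bernstein k n)) where
  mul {i j} := fun a b => grMap₂ (LinearMap.mul k (WeylAlgebra k n))
    (fun _ _ _ ha _ hb => mul_mem_bernstein ha hb) i j a b

instance : GradedMonoid.GOne (GrPiece (bernstein k n)) where
  one := grMk _ 0 1 (one_mem_bernstein k n)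

theorem gradedMk_mul {i j : ℕ} {a b : WeylAlgebra k n} (ha : a ∈ bernstein k n i)
    (hb : b ∈ bernstein k n j) :
    GradedMonoid.mk (A := GrPiece (bernstein k n)) i (grMk _ i a ha) *
      GradedMonoid.mk j (grMk _ j b hb) =
      GradedMonoid.mk (i + j) (grMk _ (i + j) (a * b) (mul_mem_bernstein ha hb)) := rfl

theorem gradedMk_one : (1 : GradedMonoid (GrPiece (bernstein k n))) =
    GradedMonoid.mk 0 (grMk _ 0 1 (one_mem_bernstein k n)) := rfl

theorem commutator_gens {a b : WeylAlgebra k n} (ha : a ∈ gens k n) (hb : b ∈ gens k n) :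
    a * b - b * a ∈ gens k n ^ 0 := by
  have h1 : (1 : WeylAlgebra k n) ∈ gens k n ^ 0 := by
    rw [pow_zero]
    exact Submodule.one_le.mp le_rfl
  induction ha using Submodule.span_induction with
  | zero => simp
  | add a a' _ _ h h' =>
    have : (a + a') * b - b * (a + a') = (a * b - b * a) + (a' * b - b * a') := by noncomm_ring
    rw [this]
    exact add_mem h h'
  | smul c a _ h =>
    have : (c • a) * b - b * (c • a) = c • (a * b - b * a) := by simp [smul_sub]
    rw [this]
    exact Submodule.smul_mem _ c h
  | mem a ha =>
    induction hb using Submodule.span_induction with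
    | zero => simp
    | add b b' _ _ h h' =>
      have : a * (b + b') - (b + b') * a = (a * b - b * a) + (a * b' - b' * a) := by noncomm_ring
      rw [this]
      exact add_mem h h'
    | smul c b _ h =>
      have : a * (c • b) - (c • b) * a = c • (a * b - b * a) := by simp [smul_sub]
      rw [this]
      exact Submodule.smul_mem _ c h
    | mem b hb =>
      rcases ha with rfl | ⟨i, rfl⟩ | ⟨i, rfl⟩
      · simp
      · rcases hb with rfl | ⟨j, rfl⟩ | ⟨j, rfl⟩
        · simp
        · simp [x_mul_x k n i j]
        · rw [d_mul_x]
          split_ifs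
          · simpa using h1
          · simp
      · rcases hb with rfl | ⟨j, rfl⟩ | ⟨j, rfl⟩
        · simp
        · rw [d_mul_x]
          split_ifs
          · simpa using h1
          · simp
        · simp [d_mul_d k n i j]

theorem mul_mem_gens_pow {i j : ℕ} {a b : WeylAlgebra k n} (ha : a ∈ gens k n ^ i)
    (hb : b ∈ gens k n ^ j) : a * b ∈ gens k n ^ (i + j) := by
  rw [pow_add]
  exact Submodule.mul_mem_mul ha hb

theorem commutator_gens_pow_right (j : ℕ) {a b : WeylAlgebra k n} (ha : a ∈ gens k n)
    (hb : b ∈ gens k n ^ j) : a * b - b * a ∈ gens k n ^ j := by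
  induction j generalizing b with
  | zero =>
    rw [pow_zero, Submodule.mem_one] at hb
    obtain ⟨c, rfl⟩ := hb
    rw [Algebra.commutes c a, sub_self]
    exact zero_mem _
  | succ j ih =>
    rw [pow_succ'] at hb
    induction hb using Submodule.mul_induction_on' with
    | mem_mul_mem v hv b hb =>
      have : a * (v * b) - v * b * a = (a * v - v * a) * b + v * (a * b - b * a) := by noncomm_ring
      rw [this]
      refine add_mem (gens_pow_mono k n (Nat.le_succ j) ?_) ?_
      · simpa using mul_mem_gens_pow k n (commutator_gens k n ha hv) hb
      · rw [pow_succ']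
        exact Submodule.mul_mem_mul hv (ih hb)
    | add b _ b' _ h h' =>
      have : a * (b + b') - (b + b') * a = (a * b - b * a) + (a * b' - b' * a) := by noncomm_ring
      rw [this]
      exact add_mem h h'

theorem commutator_mem {i j : ℕ} {a b : WeylAlgebra k n} (ha : a ∈ bernstein k n i)
    (hb : b ∈ bernstein k n j) : a * b - b * a ∈ filtPrev (bernstein k n) (i + j) := by
  have hle : ∀ m, filtPrev (bernstein k n) (m + 1) = gens k n ^ m := fun m =>
    bernstein_eq_gens_pow k n m
  rw [bernstein_eq_gens_pow] at ha hb
  induction i generalizing a with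
  | zero =>
    rw [pow_zero, Submodule.mem_one] at ha
    obtain ⟨c, rfl⟩ := ha
    rw [Algebra.commutes c b, sub_self]
    exact zero_mem _
  | succ i ih =>
    have e : i + 1 + j = i + j + 1 := by omega
    rw [e, hle]
    rw [pow_succ'] at ha
    induction ha using Submodule.mul_induction_on' with
    | mem_mul_mem v hv a ha =>
      have : v * a * b - b * (v * a) = v * (a * b - b * a) + (v * b - b * v) * a := by noncomm_ring
      rw [this]
      refine add_mem ?_ ?_
      · have h := ih ha
        rcases hm : i + j with _ | m
        · rw [hm] at h
          have h0 : a * b - b * a = 0 := h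
          rw [h0, mul_zero]
          exact zero_mem _
        · rw [hm, hle] at h
          rw [pow_succ']
          exact Submodule.mul_mem_mul hv h
      · rw [add_comm i j]
        exact mul_mem_gens_pow k n (commutator_gens_pow_right k n j hv hb) ha
    | add a _ a' _ h h' =>
      have : (a + a') * b - b * (a + a') = (a * b - b * a) + (a' * b - b * a') := by noncomm_ring
      rw [this]
      exact add_mem h h'

/-- The graded ring structure on the pieces `F_i/F_{i-1}`; it is commutative since
`[F_i, F_j] ⊆ F_{i+j-1}`. -/
instance : DirectSum.GCommRing (GrPiece (bernstein k n)) where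
  mul_zero a := map_zero (grMap₂ _ _ _ _ a)
  zero_mul b := LinearMap.map_zero₂ (grMap₂ _ _ _ _) b
  mul_add a b c := map_add (grMap₂ _ _ _ _ a) b c
  add_mul a b c := LinearMap.map_add₂ (grMap₂ _ _ _ _) a b c
  one_mul := by
    rintro ⟨i, q⟩
    obtain ⟨a, ha, rfl⟩ := grMk_surj q
    exact gradedMk_grMk_congr _ (zero_add i) _ _ (one_mul a)
  mul_one := by
    rintro ⟨i, q⟩
    obtain ⟨a, ha, rfl⟩ := grMk_surj q
    exact gradedMk_grMk_congr _ (add_zero i) _ _ (mul_one a)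
  mul_assoc := by
    rintro ⟨i, q⟩ ⟨j, r⟩ ⟨l, s⟩
    obtain ⟨a, ha, rfl⟩ := grMk_surj q
    obtain ⟨b, hb, rfl⟩ := grMk_surj r
    obtain ⟨c, hc, rfl⟩ := grMk_surj s
    exact gradedMk_grMk_congr _ (add_assoc i j l)
      (mul_mem_bernstein (mul_mem_bernstein ha hb) hc)
      (mul_mem_bernstein ha (mul_mem_bernstein hb hc)) (mul_assoc a b c)
  mul_comm := by
    rintro ⟨i, q⟩ ⟨j, r⟩
    obtain ⟨a, ha, rfl⟩ := grMk_surj q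
    obtain ⟨b, hb, rfl⟩ := grMk_surj r
    have hba : b * a ∈ bernstein k n (i + j) := add_comm j i ▸ mul_mem_bernstein hb ha
    refine (gradedMk_mul k n ha hb).trans (Eq.trans ?_ (gradedMk_mul k n hb ha).symm)
    trans GradedMonoid.mk (i + j) (grMk _ (i + j) (b * a) hba)
    · congr 1
      rw [grMk_eq_iff]
      exact commutator_mem k n ha hb
    · exact gradedMk_grMk_congr _ (add_comm i j) _ _ rfl
  natCast m := m • grMk _ 0 1 (one_mem_bernstein k n)
  natCast_zero := zero_nsmul _
  natCast_succ m := succ_nsmul _ m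
  intCast m := m • grMk _ 0 1 (one_mem_bernstein k n)
  intCast_ofNat m := natCast_zsmul _ m
  intCast_negSucc_ofNat m := negSucc_zsmul _ m

/-- The associated graded ring `gr A = ⨁_i F_i/F_{i-1}` for the Bernstein filtration. -/
abbrev Gr : Type _ := ⨁ i, GrPiece (bernstein k n) i

/-- The class `x̄_i` of `x_i` in degree one of `gr A`. -/
def xBar (i : Fin n) : Gr k n := DirectSum.of _ 1 (grMk _ 1 (x k n i) (x_mem_bernstein k n i))

/-- The class `∂̄_i` of `∂_i` in degree one of `gr A`. -/
def dBar (i : Fin n) : Gr k n := DirectSum.of _ 1 (grMk _ 1 (d k n i) (d_mem_bernstein k n i))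

/-- The ideal `Q_F = (x̄_i | i ∉ F) + (∂̄_j | j ∈ F)` of `gr A`. -/
def idealQ (F : Finset (Fin n)) : Ideal (Gr k n) :=
  Ideal.span (xBar k n '' {i | i ∉ F}) ⊔ Ideal.span (dBar k n '' {j | j ∈ F})

end GrRing

/-! ### Filtered modules, characteristic variety and multiplicities -/

/-- A filtration `Γ_0 ⊆ Γ_1 ⊆ ⋯` by `k`-subspaces of a left `A`-module `N`, exhausting `N` and
satisfying `F_i Γ_j ⊆ Γ_{i+j}`. -/
structure ModFiltration (k : Type*) [Field k] (n : ℕ) (N : Type*) [AddCommGroup N] [Module k N]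
    [Module (WeylAlgebra k n) N] [IsScalarTower k (WeylAlgebra k n) N] where
  /-- The members of the filtration. -/
  Γ : ℕ → Submodule k N
  mono : Monotone Γ
  exhaustive : ∀ y, ∃ i, y ∈ Γ i
  smul_mem : ∀ i j, ∀ a ∈ bernstein k n i, ∀ y ∈ Γ j, a • y ∈ Γ (i + j)

namespace ModFiltration

variable {k : Type*} [Field k] {n : ℕ} {N : Type*} [AddCommGroup N] [Module k N]
    [Module (WeylAlgebra k n) N] [IsScalarTower k (WeylAlgebra k n) N] (G : ModFiltration k n N)

/-- The action `F_i/F_{i-1} × Γ_j/Γ_{j-1} → Γ_{i+j}/Γ_{i+j-1}` induced by that of `A` on `N`. -/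
instance : DirectSum.Gmodule (GrPiece (bernstein k n)) (GrPiece G.Γ) where
  smul {i j} a y := grMap₂ (Γ := bernstein k n) (Γ' := G.Γ) (Γ'' := G.Γ)
    (Algebra.lsmul k k N).toLinearMap G.smul_mem i j a y
  smul_zero a := map_zero (grMap₂ _ _ _ _ a)
  zero_smul b := LinearMap.map_zero₂ (grMap₂ _ _ _ _) b
  smul_add a b c := map_add (grMap₂ _ _ _ _ a) b c
  add_smul a b c := LinearMap.map_add₂ (grMap₂ _ _ _ _) a b c
  one_smul := by
    rintro ⟨i, q⟩
    obtain ⟨y, hy, rfl⟩ := grMk_surj q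
    exact gradedMk_grMk_congr _ (zero_add i) _ _ (one_smul _ y)
  mul_smul := by
    rintro ⟨i, q⟩ ⟨j, r⟩ ⟨l, s⟩
    obtain ⟨a, ha, rfl⟩ := grMk_surj q
    obtain ⟨b, hb, rfl⟩ := grMk_surj r
    obtain ⟨y, hy, rfl⟩ := grMk_surj s
    exact gradedMk_grMk_congr _ (add_assoc i j l)
      (G.smul_mem _ _ _ (mul_mem_bernstein ha hb) _ hy)
      (G.smul_mem _ _ _ ha _ (G.smul_mem _ _ _ hb _ hy)) (mul_smul a b y)

/-- The associated graded module `gr N = ⨁_i Γ_i/Γ_{i-1}`, a module over `gr A`. -/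
abbrev Gr : Type _ := ⨁ i, GrPiece G.Γ i

/-- The filtration is good if `gr N` is a finitely generated `gr A`-module. -/
def IsGood : Prop := Module.Finite (WeylAlgebra.Gr k n) G.Gr

/-- The set of minimal associated primes of the `gr A`-module `gr N`. (For noetherian `gr A`,
Mathlib's `associatedPrimes` are the primes of the form `ann(y)`.) -/
def SS : Set (Ideal (WeylAlgebra.Gr k n)) :=
  {Q | Minimal (fun P => P ∈ associatedPrimes (WeylAlgebra.Gr k n) G.Gr) Q}

/-- The multiplicity of the `gr A`-module `gr N` at a prime `Q`: the length of the localization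
`(gr N)_Q` over `(gr A)_Q`. -/
def multiplicity (Q : Ideal (WeylAlgebra.Gr k n)) [Q.IsPrime] : ℕ∞ :=
  Module.length (Localization Q.primeCompl) (LocalizedModule Q.primeCompl G.Gr)

end ModFiltration

/-! ### The rational part of a module -/

section Rat

variable (k : Type*) [Field k] (n : ℕ) (M : Type*) [AddCommGroup M] [Module k M]
    [Module (WeylAlgebra k n) M] [IsScalarTower k (WeylAlgebra k n) M]

/-- `M_a = {y ∈ M | (x_i ∂_i) y = a_i y for all i}`. -/
def wt (a : Fin n → ℤ) : Submodule k M where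
  carrier := {y | ∀ i, (x k n i * d k n i) • y = a i • y}
  zero_mem' := by simp
  add_mem' hy hz i := by rw [smul_add, smul_add, hy i, hz i]
  smul_mem' c y hy i := by rw [smul_comm, hy i, smul_comm]

variable {k n M}

theorem mem_wt {a : Fin n → ℤ} {y : M} :
    y ∈ wt k n M a ↔ ∀ i, (x k n i * d k n i) • y = a i • y := Iff.rfl

theorem x_smul_mem_wt {a : Fin n → ℤ} {y : M} (hy : y ∈ wt k n M a) (i : Fin n) :
    x k n i • y ∈ wt k n M (a + Pi.single i 1) := by
  intro j
  have h : x k n j * d k n j * x k n i =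
      x k n i * (x k n j * d k n j) + if j = i then x k n i else 0 := by
    rw [mul_assoc, d_mul_x, mul_add, ← mul_assoc, x_mul_x, mul_assoc]
    split_ifs with hji
    · rw [mul_one, hji]
    · rw [mul_zero]
  rw [← mul_smul, h, add_smul, mul_smul, hy j, smul_comm]
  by_cases hji : j = i
  · subst hji
    simp [add_smul]
  · simp [hji]

theorem d_smul_mem_wt {a : Fin n → ℤ} {y : M} (hy : y ∈ wt k n M a) (i : Fin n) :
    d k n i • y ∈ wt k n M (a - Pi.single i 1) := by
  intro j
  have h : x k n j * d k n j * d k n i =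
      d k n i * (x k n j * d k n j) - if i = j then d k n j else 0 := by
    rw [← mul_assoc (d k n i), d_mul_x, add_mul, mul_assoc, mul_assoc, d_mul_d k n j i]
    split_ifs <;> simp
  rw [← mul_smul, h, sub_smul, mul_smul, hy j, smul_comm]
  by_cases hji : i = j
  · subst hji
    simp [sub_smul]
  · simp [hji, Ne.symm hji]

variable (k n M)

/-- `M_rat`, the sum of all the `M_a`, `a ∈ ℤⁿ`, as an `A`-submodule of `M`. (In characteristic
zero the sum is direct, the `M_a` being simultaneous eigenspaces for distinct eigenvalues.) -/
def rat : Submodule (WeylAlgebra k n) M where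
  carrier := ((⨆ a : Fin n → ℤ, wt k n M a : Submodule k M) : Set M)
  zero_mem' := zero_mem _
  add_mem' := add_mem
  smul_mem' r := by
    have key : ∀ (r : WeylAlgebra k n), (∀ a, ∀ y ∈ wt k n M a, ∃ b, r • y ∈ wt k n M b) →
        ∀ y ∈ (⨆ a : Fin n → ℤ, wt k n M a : Submodule k M),
          r • y ∈ (⨆ a : Fin n → ℤ, wt k n M a : Submodule k M) := by
      intro r hr y hy
      induction hy using Submodule.iSup_induction' with
      | mem a y hy =>
        obtain ⟨b, hb⟩ := hr a y hy
        exact Submodule.mem_iSup_of_mem b hb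
      | zero => simp
      | add y z _ _ hy hz =>
        rw [smul_add]
        exact add_mem hy hz
    induction r using induction_on with
    | hc c =>
      intro y hy
      rw [algebraMap_smul]
      exact Submodule.smul_mem _ c hy
    | hx i => exact fun {y} hy => key _ (fun a y hy => ⟨_, x_smul_mem_wt hy i⟩) y hy
    | hd i => exact fun {y} hy => key _ (fun a y hy => ⟨_, d_smul_mem_wt hy i⟩) y hy
    | hmul a b ha hb =>
      intro y hy
      rw [mul_smul]
      exact ha (hb hy)
    | hadd a b ha hb =>
      intro y hy
      rw [add_smul]
      exact add_mem (ha hy) (hb hy)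

end Rat

/-- The vector `F - 1 ∈ ℤⁿ`, where `F` is identified with its indicator vector. -/
def shiftVec {n : ℕ} (F : Finset (Fin n)) : Fin n → ℤ := fun i => (if i ∈ F then 1 else 0) - 1

end WeylAlgebra

end

/-! On a weight space `M_a` the operator `x_i` raises `a_i` by one, `∂_i` lowers it by one, and `∂_i
x_i`, `x_i ∂_i` act as the scalars `a_i + 1`, `a_i`. In characteristic zero `x_i` and `∂_i` are
therefore inverse to each other up to a nonzero scalar, except across the wall between `a_i = -1`
and `a_i = 0`. The walls cut `ℤⁿ` into orthants, one for each `F`, with corner `F - 1`; every weight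
space of that orthant is reached from the corner by a monomial in the `x_i` (`i ∈ F`) and `∂_i` (`i
∉ F`), which acts injectively.

Filter `N = M_rat` by the distance `deg` of a weight to the cube `{-1, 0}ⁿ` (`canon`). The symbol of
a vector of weight `F - 1` is killed by `Q_F`, because the generators of `Q_F` only cross walls and
do not raise the degree. The remaining generators act freely on it. Hence `gr N` is the direct sum
over `F` of `dim M_{F-1}` copies of `gr A / Q_F` (`structEquiv`).

The same computation on a polynomial model having a vector of weight `F - 1` shows that `gr A / Q_F`
is a polynomial ring, so `Q_F` is prime (`idealQ_isPrime`); different `Q_F` are incomparable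
(`eq_of_idealQ_le`). Localizing the direct sum at `Q_F` leaves only the copies of `gr A / Q_F`, each
of length one.

Two general facts complete the argument. Local lengths of `gr N` do not depend on the good
filtration (`IsGood.multiplicity_eq`), and they determine the support, hence the minimal associated
primes. Finitely generated `A`-modules are noetherian (`isNoetherian_of_finite`), and a weight space
of a noetherian module is finite dimensional, since a subspace `W` of it is recovered from `A W` as
the weight `a` part (`finiteDimensional_wt`). -/

noncomputable section

namespace WeylAlgebra

/-! ### Symbols in associated graded modules -/

section GradedHelpers

variable {k E : Type*} [Field k] [AddCommGroup E] [Module k E] {Γ : ℕ → Submodule k E}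

theorem grMk_eq_zero_iff {i : ℕ} {y : E} (hy : y ∈ Γ i) :
    grMk Γ i y hy = 0 ↔ y ∈ filtPrev Γ i := by
  rw [grMk_zero, grMk_eq_iff, sub_zero]

theorem of_grMk_congr {i j : ℕ} (h : i = j) {y z : E} (hy : y ∈ Γ i) (hz : z ∈ Γ j)
    (hyz : y = z) :
    DirectSum.of (GrPiece Γ) i (grMk Γ i y hy) = DirectSum.of (GrPiece Γ) j (grMk Γ j z hz) := by
  subst h hyz
  rfl

/-- The class of an element of `Γ_i` in degree `i` of the associated graded module, as a
linear map. -/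
def symb (Γ : ℕ → Submodule k E) (i : ℕ) : Γ i →ₗ[k] ⨁ i, GrPiece Γ i :=
  DirectSum.lof k ℕ (GrPiece Γ) i ∘ₗ ((filtPrev Γ i).submoduleOf (Γ i)).mkQ

theorem symb_apply {i : ℕ} (y : E) (hy : y ∈ Γ i) :
    symb Γ i ⟨y, hy⟩ = DirectSum.of (GrPiece Γ) i (grMk Γ i y hy) := rfl

theorem symb_congr {i j : ℕ} (h : i = j) {y z : E} (hy : y ∈ Γ i) (hz : z ∈ Γ j)
    (hyz : y = z) : symb Γ i ⟨y, hy⟩ = symb Γ j ⟨z, hz⟩ := by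
  subst h hyz
  rfl

theorem symb_eq_zero_iff {i : ℕ} (y : E) (hy : y ∈ Γ i) :
    symb Γ i ⟨y, hy⟩ = 0 ↔ y ∈ filtPrev Γ i := by
  rw [symb_apply, ← grMk_eq_zero_iff hy]
  exact map_eq_zero_iff _ (DirectSum.of_injective i)

/-- Elements of an associated graded module are sums of symbols. -/
theorem gr_induction {p : (⨁ i, GrPiece Γ i) → Prop} (z : ⨁ i, GrPiece Γ i)
    (h0 : p 0) (hs : ∀ i y (hy : y ∈ Γ i), p (symb Γ i ⟨y, hy⟩))
    (ha : ∀ z z', p z → p z' → p (z + z')) : p z := by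
  induction z using DirectSum.induction_on with
  | zero => exact h0
  | of i q =>
    obtain ⟨y, hy, rfl⟩ := grMk_surj q
    exact hs i y hy
  | add z z' hz hz' => exact ha _ _ hz hz'

theorem mem_filtPrev_of_le {k E E' : Type*} [Field k] [AddCommGroup E] [Module k E]
    [AddCommGroup E'] [Module k E'] {Γ : ℕ → Submodule k E} {Γ' : ℕ → Submodule k E'} {s : ℕ}
    (φ : E →ₗ[k] E') (h : ∀ i, ∀ y ∈ Γ i, φ y ∈ Γ' (i + s)) {i : ℕ} {y : E}
    (hy : y ∈ filtPrev Γ i) : φ y ∈ filtPrev Γ' (i + s) := by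
  rcases i with _ | i
  · obtain rfl : y = 0 := hy
    simp
  · rw [show i + 1 + s = i + s + 1 by omega]
    exact h i y hy

end GradedHelpers

/-! ### The ring `gr A`: algebra structure, generators, noetherianity -/

section Ring

variable (k : Type*) [Field k] (n : ℕ)

theorem symb_mul_symb {i j : ℕ} {a b : WeylAlgebra k n} (ha : a ∈ bernstein k n i)
    (hb : b ∈ bernstein k n j) :
    symb (bernstein k n) i ⟨a, ha⟩ * symb (bernstein k n) j ⟨b, hb⟩ =
      symb (bernstein k n) (i + j) ⟨a * b, mul_mem_bernstein ha hb⟩ := by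
  rw [symb_apply, symb_apply, DirectSum.of_mul_of]
  rfl

instance : DirectSum.GAlgebra k (GrPiece (bernstein k n)) where
  toFun :=
    { toFun := fun c => c • grMk _ 0 1 (one_mem_bernstein k n)
      map_zero' := zero_smul _ _
      map_add' := fun c c' => add_smul _ _ _ }
  map_one := one_smul _ _
  map_mul c c' := by
    refine gradedMk_grMk_congr (bernstein k n) (y := (c * c') • 1) (z := (c • 1) * (c' • 1))
      (zero_add 0).symm (Submodule.smul_mem _ _ (one_mem_bernstein k n))
      (mul_mem_bernstein (Submodule.smul_mem _ _ (one_mem_bernstein k n))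
        (Submodule.smul_mem _ _ (one_mem_bernstein k n))) ?_
    rw [smul_mul_smul_comm, one_mul]
  commutes := by
    rintro c ⟨i, q⟩
    obtain ⟨a, ha, rfl⟩ := grMk_surj q
    refine gradedMk_grMk_congr (bernstein k n) (y := (c • 1) * a) (z := a * (c • 1))
      (by omega)
      (mul_mem_bernstein (Submodule.smul_mem _ _ (one_mem_bernstein k n)) ha)
      (mul_mem_bernstein ha (Submodule.smul_mem _ _ (one_mem_bernstein k n))) ?_
    simp
  smul_def := by
    rintro c ⟨i, q⟩
    obtain ⟨a, ha, rfl⟩ := grMk_surj q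
    refine gradedMk_grMk_congr (bernstein k n) (y := c • a) (z := (c • 1) * a)
      (by omega)
      (Submodule.smul_mem _ _ ha)
      (mul_mem_bernstein (Submodule.smul_mem _ _ (one_mem_bernstein k n)) ha) ?_
    simp

theorem xBar_eq_symb (i : Fin n) :
    xBar k n i = symb (bernstein k n) 1 ⟨x k n i, x_mem_bernstein k n i⟩ := rfl

theorem dBar_eq_symb (i : Fin n) :
    dBar k n i = symb (bernstein k n) 1 ⟨d k n i, d_mem_bernstein k n i⟩ := rfl

theorem algebraMap_gr (c : k) : algebraMap k (Gr k n) c =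
    symb (bernstein k n) 0 ⟨algebraMap k _ c, by
      rw [Algebra.algebraMap_eq_smul_one]
      exact Submodule.smul_mem _ _ (one_mem_bernstein k n)⟩ := by
  rw [DirectSum.algebraMap_apply]
  exact of_grMk_congr rfl (Submodule.smul_mem _ c (one_mem_bernstein k n)) _
    (Algebra.algebraMap_eq_smul_one c).symm

theorem bernstein_exhaustive (a : WeylAlgebra k n) : ∃ i, a ∈ bernstein k n i := by
  induction a using induction_on with
  | hc c =>
    rw [Algebra.algebraMap_eq_smul_one]
    exact ⟨0, Submodule.smul_mem _ _ (one_mem_bernstein k n)⟩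
  | hx i => exact ⟨1, x_mem_bernstein k n i⟩
  | hd i => exact ⟨1, d_mem_bernstein k n i⟩
  | hmul a b ha hb =>
    obtain ⟨i, hi⟩ := ha
    obtain ⟨j, hj⟩ := hb
    exact ⟨_, mul_mem_bernstein hi hj⟩
  | hadd a b ha hb =>
    obtain ⟨i, hi⟩ := ha
    obtain ⟨j, hj⟩ := hb
    exact ⟨max i j, add_mem (bernstein_mono k n (le_max_left i j) hi)
      (bernstein_mono k n (le_max_right i j) hj)⟩

/-- Since `F_{i+1}` is `gens` times `F_i`, induction on `i` applies: a factor `x_l` or `∂_l` splits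
off as `x̄_l` or `∂̄_l`, and a factor `1` leaves an element of `F_i`, whose symbol in degree `i + 1`
is zero. -/
theorem symb_mem_adjoin (i : ℕ) (a : WeylAlgebra k n) (ha : a ∈ bernstein k n i) :
    symb (bernstein k n) i ⟨a, ha⟩ ∈
      Algebra.adjoin k (Set.range (xBar k n) ∪ Set.range (dBar k n)) := by
  set S := Algebra.adjoin k (Set.range (xBar k n) ∪ Set.range (dBar k n))
  induction i generalizing a with
  | zero =>
    have h := ha
    rw [bernstein_eq_gens_pow, pow_zero, Submodule.mem_one] at h
    obtain ⟨c, rfl⟩ := h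
    rw [← algebraMap_gr]
    exact S.algebraMap_mem c
  | succ i ih =>
    suffices ∃ z ∈ S, z = symb (bernstein k n) (i + 1) ⟨a, ha⟩ by
      obtain ⟨z, hz, h⟩ := this
      exact h ▸ hz
    have h := ha
    rw [bernstein_eq_gens_pow, pow_succ'] at h
    induction h using Submodule.mul_induction_on' with
    | add a ha' b hb' h h' =>
      rw [← pow_succ', ← bernstein_eq_gens_pow] at ha' hb'
      obtain ⟨z, hz, e⟩ := h ha'
      obtain ⟨z', hz', e'⟩ := h' hb'
      exact ⟨z + z', add_mem hz hz', by rw [e, e']; exact (map_add _ _ _).symm⟩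
    | mem_mul_mem v hv b hb =>
      rw [← bernstein_eq_gens_pow] at hb
      induction hv using Submodule.span_induction with
      | zero => exact ⟨0, zero_mem _, ((symb_eq_zero_iff _ _).mpr (by simp)).symm⟩
      | add u v hu hv h h' =>
        have hu' : u * b ∈ bernstein k n (i + 1) := by
          rw [bernstein_eq_gens_pow, pow_succ']
          rw [bernstein_eq_gens_pow] at hb
          exact Submodule.mul_mem_mul hu hb
        have hv' : v * b ∈ bernstein k n (i + 1) := by
          rw [bernstein_eq_gens_pow, pow_succ']
          rw [bernstein_eq_gens_pow] at hb
          exact Submodule.mul_mem_mul hv hb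
        obtain ⟨z, hz, e⟩ := h hu'
        obtain ⟨z', hz', e'⟩ := h' hv'
        refine ⟨z + z', add_mem hz hz', ?_⟩
        rw [e, e', ← map_add]
        exact symb_congr rfl _ _ (add_mul _ _ _).symm
      | smul c v hv h =>
        have hv' : v * b ∈ bernstein k n (i + 1) := by
          rw [bernstein_eq_gens_pow, pow_succ']
          rw [bernstein_eq_gens_pow] at hb
          exact Submodule.mul_mem_mul hv hb
        obtain ⟨z, hz, e⟩ := h hv'
        refine ⟨c • z, Subalgebra.smul_mem _ hz c, ?_⟩
        rw [e, ← map_smul]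
        exact symb_congr rfl _ _ (smul_mul_assoc _ _ _).symm
      | mem v hv =>
        rcases hv with hv | ⟨l, rfl⟩ | ⟨l, rfl⟩
        · obtain rfl : v = 1 := hv
          refine ⟨0, zero_mem _, ((symb_eq_zero_iff _ _).mpr ?_).symm⟩
          rw [one_mul]
          exact hb
        · refine ⟨xBar k n l * symb _ i ⟨b, hb⟩, mul_mem (Algebra.subset_adjoin (by simp))
            (ih b hb), ?_⟩
          rw [xBar_eq_symb, symb_mul_symb]
          exact symb_congr (add_comm _ _) _ _ rfl
        · refine ⟨dBar k n l * symb _ i ⟨b, hb⟩, mul_mem (Algebra.subset_adjoin (by simp))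
            (ih b hb), ?_⟩
          rw [dBar_eq_symb, symb_mul_symb]
          exact symb_congr (add_comm _ _) _ _ rfl

theorem adjoin_gr : Algebra.adjoin k (Set.range (xBar k n) ∪ Set.range (dBar k n)) = ⊤ := by
  rw [eq_top_iff]
  rintro z -
  induction z using gr_induction with
  | h0 => exact zero_mem _
  | hs i a ha => exact symb_mem_adjoin k n i a ha
  | ha z z' h h' => exact add_mem h h'

instance : IsNoetherianRing (Gr k n) := by
  have : Algebra.FiniteType k (Gr k n) := by
    refine ⟨(Set.Finite.toFinset (s := Set.range (xBar k n) ∪ Set.range (dBar k n))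
      ((Set.finite_range _).union (Set.finite_range _))), ?_⟩
    rw [Set.Finite.coe_toFinset, adjoin_gr]
  exact Algebra.FiniteType.isNoetherianRing k _

end Ring

/-! ### Filtered maps, induced and generated filtrations -/

namespace ModFiltration

variable {k : Type*} [Field k] {n : ℕ} {N : Type*} [AddCommGroup N] [Module k N]
    [Module (WeylAlgebra k n) N] [IsScalarTower k (WeylAlgebra k n) N]
    {N' : Type*} [AddCommGroup N'] [Module k N']
    [Module (WeylAlgebra k n) N'] [IsScalarTower k (WeylAlgebra k n) N']

theorem symb_smul_symb (G : ModFiltration k n N) {i j : ℕ} {a : WeylAlgebra k n} {y : N}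
    (ha : a ∈ bernstein k n i) (hy : y ∈ G.Γ j) :
    symb (bernstein k n) i ⟨a, ha⟩ • (symb G.Γ j ⟨y, hy⟩ : G.Gr) =
      (symb G.Γ (i + j) ⟨a • y, G.smul_mem _ _ _ ha _ hy⟩ : G.Gr) := by
  rw [symb_apply, symb_apply, DirectSum.Gmodule.of_smul_of]
  rfl

instance (G : ModFiltration k n N) : IsScalarTower k (WeylAlgebra.Gr k n) G.Gr := by
  refine IsScalarTower.of_algebraMap_smul fun c z => ?_
  induction z using gr_induction with
  | h0 => simp only [smul_zero]
  | hs i y hy =>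
    rw [algebraMap_gr, symb_smul_symb, ← map_smul]
    exact symb_congr (zero_add i) _ _ (algebraMap_smul _ c y)
  | ha z z' h h' => rw [smul_add, smul_add, h, h']

/-- The `k`-linear map underlying `grHom`. -/
def grLinear (G : ModFiltration k n N) (G' : ModFiltration k n N') (s : ℕ)
    (φ : N →ₗ[WeylAlgebra k n] N') (h : ∀ i, ∀ y ∈ G.Γ i, φ y ∈ G'.Γ (i + s)) :
    G.Gr →ₗ[k] G'.Gr :=
  DirectSum.toModule k ℕ _ fun i =>
    DirectSum.lof k ℕ (GrPiece G'.Γ) (i + s) ∘ₗ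
      Submodule.mapQ ((filtPrev G.Γ i).submoduleOf (G.Γ i)) _
        ((φ.restrictScalars k).restrict (p := G.Γ i) (q := G'.Γ (i + s)) (h i))
        (fun _ hb => mem_filtPrev_of_le (φ.restrictScalars k) h hb)

theorem grLinear_symb (G : ModFiltration k n N) (G' : ModFiltration k n N') (s : ℕ)
    (φ : N →ₗ[WeylAlgebra k n] N') (h : ∀ i, ∀ y ∈ G.Γ i, φ y ∈ G'.Γ (i + s))
    (i : ℕ) (y : N) (hy : y ∈ G.Γ i) :
    grLinear G G' s φ h (symb G.Γ i ⟨y, hy⟩) = symb G'.Γ (i + s) ⟨φ y, h i y hy⟩ :=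
  DirectSum.toModule_lof _ _ _

theorem grLinear_smul (G : ModFiltration k n N) (G' : ModFiltration k n N') (s : ℕ)
    (φ : N →ₗ[WeylAlgebra k n] N') (h : ∀ i, ∀ y ∈ G.Γ i, φ y ∈ G'.Γ (i + s))
    (r : WeylAlgebra.Gr k n) (z : G.Gr) :
    grLinear G G' s φ h (r • z) = r • grLinear G G' s φ h z := by
  induction r using gr_induction with
  | h0 => simp only [zero_smul, map_zero]
  | ha r r' hr hr' => rw [add_smul, map_add, hr, hr', add_smul]
  | hs i a ha =>
    induction z using gr_induction with
    | h0 => simp only [smul_zero, map_zero]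
    | ha z z' hr hr' => rw [smul_add, map_add, map_add, hr, hr', smul_add]
    | hs j y hy =>
      rw [symb_smul_symb, grLinear_symb, grLinear_symb, symb_smul_symb]
      exact symb_congr (add_assoc _ _ _) _ _ (map_smul φ a y)

/-- The map of associated graded modules induced by a linear map which shifts the filtrations
by at most `s`. -/
def grHom (G : ModFiltration k n N) (G' : ModFiltration k n N') (s : ℕ)
    (φ : N →ₗ[WeylAlgebra k n] N') (h : ∀ i, ∀ y ∈ G.Γ i, φ y ∈ G'.Γ (i + s)) :
    G.Gr →ₗ[WeylAlgebra.Gr k n] G'.Gr where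
  toFun := grLinear G G' s φ h
  map_add' := map_add _
  map_smul' := grLinear_smul G G' s φ h

theorem grHom_symb (G : ModFiltration k n N) (G' : ModFiltration k n N') (s : ℕ)
    (φ : N →ₗ[WeylAlgebra k n] N') (h : ∀ i, ∀ y ∈ G.Γ i, φ y ∈ G'.Γ (i + s))
    (i : ℕ) (y : N) (hy : y ∈ G.Γ i) :
    grHom G G' s φ h (symb G.Γ i ⟨y, hy⟩) = symb G'.Γ (i + s) ⟨φ y, h i y hy⟩ :=
  grLinear_symb G G' s φ h i y hy

theorem component_symb {E : Type*} [AddCommGroup E] [Module k E] {Γ : ℕ → Submodule k E}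
    (i j : ℕ) (y : E) (hy : y ∈ Γ i) (hij : i ≠ j) :
    (symb Γ i ⟨y, hy⟩ : ⨁ i, GrPiece Γ i) j = 0 :=
  DirectSum.of_eq_of_ne _ _ _ hij.symm

theorem symb_self {E : Type*} [AddCommGroup E] [Module k E] {Γ : ℕ → Submodule k E}
    (i : ℕ) (y : E) (hy : y ∈ Γ i) :
    (symb Γ i ⟨y, hy⟩ : ⨁ i, GrPiece Γ i) i = grMk Γ i y hy :=
  DirectSum.of_eq_same _ _

/-- This turns statements about the kernel and image of `grHom` into statements about
representatives, one degree at a time. -/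
theorem grHom_apply (G : ModFiltration k n N) (G' : ModFiltration k n N') (s : ℕ)
    (φ : N →ₗ[WeylAlgebra k n] N') (h : ∀ i, ∀ y ∈ G.Γ i, φ y ∈ G'.Γ (i + s))
    (z : G.Gr) (i : ℕ) (y : N) (hy : y ∈ G.Γ i) (hz : z i = grMk G.Γ i y hy) :
    grHom G G' s φ h z (i + s) = grMk G'.Γ (i + s) (φ y) (h i y hy) := by
  induction z using gr_induction generalizing y with
  | h0 =>
    rw [map_zero]
    refine ((grMk_eq_zero_iff _).mpr ?_).symm
    exact mem_filtPrev_of_le (φ.restrictScalars k) h ((grMk_eq_zero_iff hy).mp hz.symm)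
  | hs j u hu =>
    rw [grHom_symb]
    by_cases hij : j = i
    · subst hij
      rw [symb_self] at hz ⊢
      rw [grMk_eq_iff] at hz ⊢
      rw [← map_sub]
      exact mem_filtPrev_of_le (φ.restrictScalars k) h hz
    · rw [component_symb _ _ _ _ hij] at hz
      rw [component_symb _ _ _ _ (by omega)]
      refine ((grMk_eq_zero_iff _).mpr ?_).symm
      exact mem_filtPrev_of_le (φ.restrictScalars k) h ((grMk_eq_zero_iff hy).mp hz.symm)
  | ha z z' ih ih' =>
    obtain ⟨u, hu, e⟩ := grMk_surj (z i)
    obtain ⟨u', hu', e'⟩ := grMk_surj (z' i)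
    rw [map_add, DirectSum.add_apply, ih u hu e.symm, ih' u' hu' e'.symm, grMk_add, grMk_eq_iff,
      ← map_add, ← map_sub]
    refine mem_filtPrev_of_le (φ.restrictScalars k) h
      ((grMk_eq_iff G.Γ (add_mem hu hu') hy).mp ?_)
    rw [← hz, ← grMk_add _ hu hu', e, e']
    rfl

/-- An element of the associated graded module is the sum of symbols of representatives of its
components. -/
theorem mem_of_forall_component {E : Type*} [AddCommGroup E] [Module k E] {Γ : ℕ → Submodule k E}
    {S : Type*} [SetLike S (⨁ i, GrPiece Γ i)] [AddSubmonoidClass S (⨁ i, GrPiece Γ i)] (p : S)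
    (z : ⨁ i, GrPiece Γ i)
    (h : ∀ i y (hy : y ∈ Γ i), z i = grMk Γ i y hy → symb Γ i ⟨y, hy⟩ ∈ p) : z ∈ p := by
  classical
  rw [← DirectSum.sum_support_of z]
  refine sum_mem fun i _ => ?_
  obtain ⟨y, hy, e⟩ := grMk_surj (z i)
  rw [← e]
  exact h i y hy e.symm

/-- A strict filtered map which is injective induces an injective map of associated graded
modules. -/
theorem grHom_injective (G : ModFiltration k n N) (G' : ModFiltration k n N')
    (φ : N →ₗ[WeylAlgebra k n] N') (hφ : Function.Injective φ)
    (h : ∀ i y, y ∈ G.Γ i ↔ φ y ∈ G'.Γ i) :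
    Function.Injective (grHom G G' 0 φ fun i y => (h i y).mp) := by
  rw [← LinearMap.ker_eq_bot, eq_bot_iff]
  intro z hz
  rw [LinearMap.mem_ker] at hz
  refine mem_of_forall_component (⊥ : Submodule (WeylAlgebra.Gr k n) G.Gr) z fun i y hy e => ?_
  have := grHom_apply G G' 0 φ (fun i y => (h i y).mp) z i y hy e
  rw [hz, DirectSum.zero_apply, eq_comm, grMk_eq_zero_iff] at this
  rw [Submodule.mem_bot, symb_eq_zero_iff]
  rcases i with _ | i
  · have h0 : φ y = 0 := this
    exact hφ (h0.trans (map_zero φ).symm)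
  · exact (h i y).mpr this

/-- If the induced map of associated graded modules is surjective then the filtered map is. -/
theorem le_map_of_grHom_surjective (G : ModFiltration k n N) (G' : ModFiltration k n N')
    (φ : N →ₗ[WeylAlgebra k n] N') (h : ∀ i, ∀ y ∈ G.Γ i, φ y ∈ G'.Γ i)
    (hs : Function.Surjective (grHom G G' 0 φ h)) (i : ℕ) (y : N') (hy : y ∈ G'.Γ i) :
    ∃ u ∈ G.Γ i, φ u = y := by
  induction i generalizing y with
  | zero =>
    obtain ⟨z, hz⟩ := hs (symb G'.Γ 0 ⟨y, hy⟩)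
    obtain ⟨u, hu, e⟩ := grMk_surj (z 0)
    have := grHom_apply G G' 0 φ h z 0 u hu e.symm
    rw [hz, symb_self, grMk_eq_iff] at this
    exact ⟨u, hu, (sub_eq_zero.mp this).symm⟩
  | succ i ih =>
    obtain ⟨z, hz⟩ := hs (symb G'.Γ (i + 1) ⟨y, hy⟩)
    obtain ⟨u, hu, e⟩ := grMk_surj (z (i + 1))
    have := grHom_apply G G' 0 φ h z (i + 1) u hu e.symm
    rw [hz, symb_self, grMk_eq_iff] at this
    -- The error `y - φ u` lies one level lower, so it lifts by induction.
    obtain ⟨v, hv, e⟩ := ih _ this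
    exact ⟨v + u, add_mem (G.mono (Nat.le_succ i) hv) hu, by rw [map_add, e, sub_add_cancel]⟩

/-- The filtration induced on a submodule. -/
def induced (G : ModFiltration k n N) (S : Submodule (WeylAlgebra k n) N) :
    ModFiltration k n S where
  Γ i := (G.Γ i).comap (S.subtype.restrictScalars k)
  mono _ _ hij := Submodule.comap_mono (G.mono hij)
  exhaustive y := G.exhaustive y
  smul_mem i j a ha y hy := G.smul_mem i j a ha y hy

/-- The graded module of the induced filtration embeds in `gr N`, which is a noetherian module
because `gr A` is a noetherian ring. -/
theorem IsGood.induced {G : ModFiltration k n N} (hG : G.IsGood)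
    (S : Submodule (WeylAlgebra k n) N) : (G.induced S).IsGood := by
  have : Module.Finite (WeylAlgebra.Gr k n) G.Gr := hG
  exact Module.Finite.of_injective _
    (grHom_injective (G.induced S) G S.subtype S.injective_subtype fun _ _ => Iff.rfl)

variable (k n) in
/-- The filtration `F_i • V` generated by a subset. -/
def generated (V : Set N) (hV : Submodule.span (WeylAlgebra k n) V = ⊤) : ModFiltration k n N where
  Γ i := Submodule.span k {y | ∃ a ∈ bernstein k n i, ∃ v ∈ V, a • v = y}
  mono i j hij := Submodule.span_mono fun y ⟨a, ha, h⟩ => ⟨a, bernstein_mono k n hij ha, h⟩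
  exhaustive y := by
    have hy : y ∈ Submodule.span (WeylAlgebra k n) V := hV ▸ Submodule.mem_top
    have hmono : ∀ {i j : ℕ}, i ≤ j →
        Submodule.span k {y | ∃ a ∈ bernstein k n i, ∃ v ∈ V, a • v = y} ≤
        Submodule.span k {y | ∃ a ∈ bernstein k n j, ∃ v ∈ V, a • v = y} := fun hij =>
      Submodule.span_mono fun y ⟨a, ha, h⟩ => ⟨a, bernstein_mono k n hij ha, h⟩
    induction hy using Submodule.span_induction with
    | zero => exact ⟨0, zero_mem _⟩
    | mem y hy => exact ⟨0, Submodule.subset_span ⟨1, one_mem_bernstein k n, y, hy, one_smul _ _⟩⟩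
    | add y z _ _ h h' =>
      obtain ⟨i, hi⟩ := h
      obtain ⟨j, hj⟩ := h'
      exact ⟨max i j, add_mem (hmono (le_max_left i j) hi) (hmono (le_max_right i j) hj)⟩
    | smul a y _ h =>
      obtain ⟨j, hj⟩ := h
      obtain ⟨i, hi⟩ := bernstein_exhaustive k n a
      refine ⟨i + j, ?_⟩
      rename_i hy0
      clear hy0
      induction hj using Submodule.span_induction with
      | zero => simp
      | add y z _ _ h h' => rw [smul_add]; exact add_mem h h'
      | smul c y _ h => rw [smul_comm]; exact Submodule.smul_mem _ c h
      | mem y hy =>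
        obtain ⟨b, hb, v, hv, rfl⟩ := hy
        exact Submodule.subset_span ⟨a * b, mul_mem_bernstein hi hb, v, hv, mul_smul _ _ _⟩
  smul_mem i j a ha y hy := by
    induction hy using Submodule.span_induction with
    | zero => simp
    | add y z _ _ h h' => rw [smul_add]; exact add_mem h h'
    | smul c y _ h => rw [smul_comm]; exact Submodule.smul_mem _ c h
    | mem y hy =>
      obtain ⟨b, hb, v, hv, rfl⟩ := hy
      exact Submodule.subset_span ⟨a * b, mul_mem_bernstein ha hb, v, hv, mul_smul _ _ _⟩

theorem mem_generated {V : Set N} (hV : Submodule.span (WeylAlgebra k n) V = ⊤) {v : N}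
    (hv : v ∈ V) : v ∈ (generated k n V hV).Γ 0 :=
  Submodule.subset_span ⟨1, one_mem_bernstein k n, v, hv, one_smul _ _⟩

/-- The symbol of `a • v` is the symbol of `a` times that of `v`, so the degree zero symbols of `V`
generate. -/
theorem generated_isGood {V : Set N} (hV : Submodule.span (WeylAlgebra k n) V = ⊤)
    (hf : V.Finite) : (generated k n V hV).IsGood := by
  have : Finite V := hf
  let G := generated k n V hV
  refine ⟨Submodule.fg_def.mpr
    ⟨Set.range fun v : V => symb G.Γ 0 ⟨v, mem_generated hV v.2⟩, Set.finite_range _, ?_⟩⟩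
  rw [eq_top_iff]
  rintro z -
  set S : Submodule (WeylAlgebra.Gr k n) G.Gr :=
    Submodule.span _ (Set.range fun v : V => symb G.Γ 0 ⟨v, mem_generated hV v.2⟩)
  induction z using gr_induction with
  | h0 => exact zero_mem _
  | ha z z' h h' => exact add_mem h h'
  | hs i y hy =>
    suffices ∃ z ∈ S, z = symb G.Γ i ⟨y, hy⟩ by
      obtain ⟨z, hz, h⟩ := this
      exact h ▸ hz
    have h := hy
    change y ∈ Submodule.span k {y | ∃ a ∈ bernstein k n i, ∃ v ∈ V, a • v = y} at h
    induction h using Submodule.span_induction with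
    | zero => exact ⟨0, zero_mem _, (map_zero _).symm⟩
    | add u v hu hv h h' =>
      obtain ⟨z, hz, e⟩ := h hu
      obtain ⟨z', hz', e'⟩ := h' hv
      exact ⟨z + z', add_mem hz hz', by rw [e, e']; exact (map_add _ _ _).symm⟩
    | smul c v hv h =>
      obtain ⟨z, hz, e⟩ := h hv
      refine ⟨c • z, ?_, by rw [e]; exact (map_smul _ _ _).symm⟩
      rw [← algebraMap_smul (WeylAlgebra.Gr k n) c z]
      exact Submodule.smul_mem _ _ hz
    | mem y hm =>
      obtain ⟨a, ha, v, hv, rfl⟩ := hm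
      refine ⟨symb _ i ⟨a, ha⟩ • (symb G.Γ 0 ⟨v, mem_generated hV hv⟩ : G.Gr),
        Submodule.smul_mem _ _ (Submodule.subset_span ⟨⟨v, hv⟩, rfl⟩), ?_⟩
      rw [symb_smul_symb]
      exact symb_congr (add_zero i) _ _ rfl

/-- The associated graded module of a good filtration is generated by finitely many symbols. -/
theorem IsGood.exists_symbols {G : ModFiltration k n N} (hG : G.IsGood) :
    ∃ V : Set (ℕ × N), V.Finite ∧ ∀ P : Submodule (WeylAlgebra.Gr k n) G.Gr,
      (∀ p ∈ V, ∀ h : p.2 ∈ G.Γ p.1, symb G.Γ p.1 ⟨p.2, h⟩ ∈ P) → P = ⊤ := by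
  classical
  obtain ⟨T, hT⟩ := hG
  choose r hr hr' using fun (z : G.Gr) (i : ℕ) => grMk_surj (z i)
  refine ⟨⋃ z ∈ T, ⋃ i ∈ z.support, {(i, r z i)}, ?_, fun P hP => ?_⟩
  · exact T.finite_toSet.biUnion fun z _ => z.support.finite_toSet.biUnion fun i _ =>
      Set.finite_singleton _
  · rw [eq_top_iff, ← hT, Submodule.span_le]
    intro z hz
    rw [SetLike.mem_coe, ← DirectSum.sum_support_of z]
    refine sum_mem fun i hi => ?_
    rw [← hr' z i]
    refine hP (i, r z i) ?_ (hr z i)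
    simp only [Set.mem_iUnion]
    exact ⟨z, hz, i, hi, rfl⟩

/-- A filtered module with a good filtration is finitely generated. -/
theorem IsGood.module_finite {G : ModFiltration k n N} (hG : G.IsGood) :
    Module.Finite (WeylAlgebra k n) N := by
  obtain ⟨V, hV, h⟩ := hG.exists_symbols
  set S := Submodule.span (WeylAlgebra k n) (Prod.snd '' V)
  -- The representatives generate a submodule `S`. The image of `gr S` contains the generating
  -- symbols, so `gr S` maps onto `gr N`, and this surjectivity lifts to `S = N`.
  have hs := h (LinearMap.range (grHom (G.induced S) G 0 S.subtype fun _ _ h => h)) ?_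
  · refine ⟨Submodule.fg_def.mpr ⟨Prod.snd '' V, hV.image _, ?_⟩⟩
    rw [eq_top_iff]
    rintro y -
    obtain ⟨i, hi⟩ := G.exhaustive y
    obtain ⟨u, -, rfl⟩ := le_map_of_grHom_surjective _ _ _ _ (LinearMap.range_eq_top.mp hs) i y hi
    exact u.2
  · intro p hp hp'
    exact ⟨symb (G.induced S).Γ p.1 ⟨⟨p.2, Submodule.subset_span ⟨p, hp, rfl⟩⟩, hp'⟩,
      grHom_symb _ _ _ _ _ _ _ _⟩

end ModFiltration

/-! ### Finitely generated `A`-modules are noetherian -/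

theorem exists_isGood (k : Type*) [Field k] (n : ℕ) (M : Type*) [AddCommGroup M] [Module k M]
    [Module (WeylAlgebra k n) M] [IsScalarTower k (WeylAlgebra k n) M]
    [h : Module.Finite (WeylAlgebra k n) M] : ∃ G : ModFiltration k n M, G.IsGood := by
  obtain ⟨V, hV, hV'⟩ := Submodule.fg_def.mp h.fg_top
  exact ⟨_, ModFiltration.generated_isGood hV' hV⟩

/-- Every submodule inherits a good filtration, and a module with a good filtration is finitely
generated. -/
theorem isNoetherian_of_finite (k : Type*) [Field k] (n : ℕ) (M : Type*) [AddCommGroup M]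
    [Module k M] [Module (WeylAlgebra k n) M] [IsScalarTower k (WeylAlgebra k n) M]
    [h : Module.Finite (WeylAlgebra k n) M] : IsNoetherian (WeylAlgebra k n) M := by
  obtain ⟨G, hG⟩ := exists_isGood k n M
  refine ⟨fun S => ?_⟩
  have := (hG.induced S).module_finite
  exact Module.Finite.iff_fg.mp this

end WeylAlgebra

/-- The length of the localization of a module at a prime. -/
def Module.localLength {R : Type*} [CommRing R] (Q : Ideal R) [Q.IsPrime] (X : Type*)
    [AddCommGroup X] [Module R X] : ℕ∞ :=
  Module.length (Localization Q.primeCompl) (LocalizedModule Q.primeCompl X)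

/-! ### Lengths of localizations -/

section LocalLength

variable {R : Type*} [CommRing R]

/-- Each length is the length of a kernel plus that of a range. Exactness makes the kernel of either
map the range of the other, so both lengths equal the sum of the lengths of the two ranges. -/
theorem Module.length_eq_of_exact_exact {X Y : Type*} [AddCommGroup X] [Module R X]
    [AddCommGroup Y] [Module R Y] (f : X →ₗ[R] Y) (g : Y →ₗ[R] X) (h : Function.Exact f g)
    (h' : Function.Exact g f) : Module.length R X = Module.length R Y := by
  have hX := Module.length_eq_add_of_exact (LinearMap.ker f).subtype f.rangeRestrict
    (Submodule.injective_subtype _) f.surjective_rangeRestrict (by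
      rw [LinearMap.exact_iff, LinearMap.ker_rangeRestrict, Submodule.range_subtype])
  have hY := Module.length_eq_add_of_exact (LinearMap.ker g).subtype g.rangeRestrict
    (Submodule.injective_subtype _) g.surjective_rangeRestrict (by
      rw [LinearMap.exact_iff, LinearMap.ker_rangeRestrict, Submodule.range_subtype])
  rw [hX, hY, LinearMap.exact_iff.mp h, LinearMap.exact_iff.mp h', add_comm]

variable (Q : Ideal R) [Q.IsPrime]

theorem Module.localLength_eq_of_exact_exact {X Y : Type*} [AddCommGroup X] [Module R X]
    [AddCommGroup Y] [Module R Y] (f : X →ₗ[R] Y) (g : Y →ₗ[R] X) (h : Function.Exact f g)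
    (h' : Function.Exact g f) : Module.localLength Q X = Module.localLength Q Y :=
  Module.length_eq_of_exact_exact (LocalizedModule.map Q.primeCompl f)
    (LocalizedModule.map Q.primeCompl g) (LocalizedModule.map_exact _ f g h)
    (LocalizedModule.map_exact _ g f h')

theorem Module.localLength_ne_zero_iff {X : Type*} [AddCommGroup X] [Module R X] :
    Module.localLength Q X ≠ 0 ↔ (⟨Q, inferInstance⟩ : PrimeSpectrum R) ∈ Module.support R X := by
  rw [Module.localLength, ← pos_iff_ne_zero, Module.length_pos_iff, Module.mem_support_iff]

end LocalLength

/-! ### Independence of multiplicities from the good filtration -/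

namespace WeylAlgebra

namespace ModFiltration

variable {k : Type*} [Field k] {n : ℕ} {N : Type*} [AddCommGroup N] [Module k N]
    [Module (WeylAlgebra k n) N] [IsScalarTower k (WeylAlgebra k n) N]
    (Q : Ideal (WeylAlgebra.Gr k n)) [Q.IsPrime]

theorem multiplicity_eq_localLength (G : ModFiltration k n N) :
    G.multiplicity Q = Module.localLength Q G.Gr := rfl

/-- When `Γ_i ⊆ Γ'_i ⊆ Γ_{i+1}`, the identity induces maps `f : gr → gr'` of degree 0 and `g : gr' →
gr` of degree 1. In degree `i` the kernel of `f` is `Γ'_{i-1}/Γ_{i-1}`, the image of `g`, and the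
kernel of `g` is `Γ_i/Γ'_{i-1}`, the image of `f`. -/
theorem multiplicity_eq_of_adjacent (G G' : ModFiltration k n N) (h : ∀ i, G.Γ i ≤ G'.Γ i)
    (h' : ∀ i, G'.Γ i ≤ G.Γ (i + 1)) : G.multiplicity Q = G'.multiplicity Q := by
  set f := grHom G G' 0 LinearMap.id fun i y hy => h i hy
  set g := grHom G' G 1 LinearMap.id fun i y hy => h' i hy
  refine Module.localLength_eq_of_exact_exact Q f g (LinearMap.exact_iff.mpr ?_)
    (LinearMap.exact_iff.mpr ?_)
  · refine le_antisymm (fun z hz => ?_) ?_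
    · refine mem_of_forall_component (LinearMap.range f) z fun i y hy e => ?_
      have := grHom_apply G' G 1 LinearMap.id (fun i y hy => h' i hy) z i y hy e
      rw [show grHom G' G 1 LinearMap.id (fun i y hy => h' i hy) z = 0 from hz,
        DirectSum.zero_apply, eq_comm, grMk_eq_zero_iff] at this
      exact ⟨symb G.Γ i ⟨y, this⟩, grHom_symb _ _ _ _ _ _ _ _⟩
    · rintro _ ⟨z, rfl⟩
      rw [LinearMap.mem_ker]
      induction z using gr_induction with
      | h0 => simp only [map_zero]
      | ha z z' hz hz' => rw [map_add, map_add, hz, hz', add_zero]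
      | hs i y hy =>
        rw [grHom_symb, grHom_symb, symb_eq_zero_iff]
        exact hy
  · refine le_antisymm (fun z hz => ?_) ?_
    · refine mem_of_forall_component (LinearMap.range g) z fun i y hy e => ?_
      have := grHom_apply G G' 0 LinearMap.id (fun i y hy => h i hy) z i y hy e
      rw [show grHom G G' 0 LinearMap.id (fun i y hy => h i hy) z = 0 from hz,
        DirectSum.zero_apply, eq_comm, grMk_eq_zero_iff] at this
      -- In degree 0 nothing comes from `g`, but `Γ'_{-1} = 0` makes the symbol vanish.
      rcases i with _ | i
      · rw [(symb_eq_zero_iff y hy).mpr this]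
        exact zero_mem _
      · exact ⟨symb G'.Γ i ⟨y, this⟩, grHom_symb _ _ _ _ _ _ _ _⟩
    · rintro _ ⟨z, rfl⟩
      rw [LinearMap.mem_ker]
      induction z using gr_induction with
      | h0 => simp only [map_zero]
      | ha z z' hz hz' => rw [map_add, map_add, hz, hz', add_zero]
      | hs i y hy =>
        rw [grHom_symb, grHom_symb, symb_eq_zero_iff]
        exact hy

/-- The filtration `Γ_{i+s}`. -/
def shift (G : ModFiltration k n N) (s : ℕ) : ModFiltration k n N where
  Γ i := G.Γ (i + s)
  mono i j hij := G.mono (by omega)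
  exhaustive y := by
    obtain ⟨i, hi⟩ := G.exhaustive y
    exact ⟨i, G.mono (by omega) hi⟩
  smul_mem i j a ha y hy := by
    rw [add_assoc]
    exact G.smul_mem _ _ _ ha _ hy

/-- The intersection of two filtrations. -/
def inter (G G' : ModFiltration k n N) : ModFiltration k n N where
  Γ i := G.Γ i ⊓ G'.Γ i
  mono i j hij := inf_le_inf (G.mono hij) (G'.mono hij)
  exhaustive y := by
    obtain ⟨i, hi⟩ := G.exhaustive y
    obtain ⟨j, hj⟩ := G'.exhaustive y
    exact ⟨max i j, G.mono (le_max_left i j) hi, G'.mono (le_max_right i j) hj⟩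
  smul_mem i j a ha y hy := ⟨G.smul_mem _ _ _ ha _ hy.1, G'.smul_mem _ _ _ ha _ hy.2⟩

/-- The filtration `Γ_{i+1} ∩ Γ'_i` is adjacent to `Γ` and closer to `Γ'` by one step, which allows
induction on `c`. -/
theorem multiplicity_eq_of_le_of_le (c : ℕ) (G G' : ModFiltration k n N)
    (h : ∀ i, G.Γ i ≤ G'.Γ i) (h' : ∀ i, G'.Γ i ≤ G.Γ (i + c)) :
    G.multiplicity Q = G'.multiplicity Q := by
  induction c generalizing G with
  | zero =>
    exact multiplicity_eq_of_adjacent Q G G' h fun i => (h' i).trans (G.mono (by omega))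
  | succ c ih =>
    trans ((G.shift 1).inter G').multiplicity Q
    · exact multiplicity_eq_of_adjacent Q _ _ (fun i => le_inf (G.mono (Nat.le_succ i)) (h i))
        fun i => inf_le_left
    · refine ih _ (fun i => inf_le_right) fun i => le_inf ?_ (G'.mono (by omega))
      refine (h' i).trans (G.mono ?_)
      omega

theorem multiplicity_shift (G : ModFiltration k n N) (s : ℕ) :
    G.multiplicity Q = (G.shift s).multiplicity Q :=
  multiplicity_eq_of_le_of_le Q s _ _ (fun i => G.mono (by omega)) fun _ => le_rfl

/-- A good filtration is contained in a shift of any other filtration. -/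
theorem IsGood.exists_le {G : ModFiltration k n N} (hG : G.IsGood) (G' : ModFiltration k n N) :
    ∃ s, ∀ i, G.Γ i ≤ G'.Γ (i + s) := by
  obtain ⟨V, hV, h⟩ := hG.exists_symbols
  choose t ht using G'.exhaustive
  -- The shift `s` bounds the levels of `G'` in which the generators lie. Then `Γ_i ∩ Γ'_{i+s}`
  -- contains all the generating representatives at their own levels, so it exhausts `Γ_i`.
  obtain ⟨s, hs⟩ := (hV.image fun p => t p.2).bddAbove
  have := h (LinearMap.range (grHom (G.inter (G'.shift s)) G 0 LinearMap.id
    fun i y hy => hy.1)) ?_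
  · refine ⟨s, fun i y hy => ?_⟩
    obtain ⟨u, hu, rfl⟩ :=
      le_map_of_grHom_surjective _ _ _ _ (LinearMap.range_eq_top.mp this) i y hy
    exact hu.2
  · intro p hp hp'
    have hps : t p.2 ≤ s := hs ⟨p, hp, rfl⟩
    refine ⟨symb _ p.1 ⟨p.2, hp', G'.mono ?_ (ht p.2)⟩, grHom_symb _ _ _ _ _ _ _ _⟩
    omega

/-- The multiplicities do not depend on the good filtration. -/
theorem IsGood.multiplicity_eq {G G' : ModFiltration k n N} (hG : G.IsGood) (hG' : G'.IsGood) :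
    G.multiplicity Q = G'.multiplicity Q := by
  obtain ⟨s, hs⟩ := hG.exists_le G'
  obtain ⟨t, ht⟩ := hG'.exists_le G
  rw [multiplicity_shift Q G' s]
  refine multiplicity_eq_of_le_of_le Q (s + t) _ _ hs fun i => (ht (i + s)).trans (G.mono ?_)
  omega

end ModFiltration
end WeylAlgebra

namespace WeylAlgebra

theorem natVec_induction {ι : Type*} [Fintype ι] [DecidableEq ι] {p : (ι → ℕ) → Prop}
    (zero : p 0) (add_single : ∀ c i, p c → p (c + Pi.single i 1)) (c : ι → ℕ) : p c := by
  induction hm : ∑ i, c i generalizing c with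
  | zero =>
    have : c = 0 := funext fun i => (Finset.sum_eq_zero_iff.mp hm) i (Finset.mem_univ i)
    exact this ▸ zero
  | succ m ih =>
    obtain ⟨i, -, hi⟩ : ∃ i ∈ Finset.univ, c i ≠ 0 := by
      by_contra! h
      rw [Finset.sum_eq_zero h] at hm
      omega
    have hc : c - Pi.single i 1 + Pi.single i 1 = c := by
      funext j
      by_cases hj : j = i
      · subst hj
        simp
        omega
      · simp [hj]
    rw [← hc]
    refine add_single _ _ (ih _ ?_)
    rw [← hc] at hm
    simp only [Pi.add_apply, Finset.sum_add_distrib, Finset.sum_pi_single', Finset.mem_univ,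
      if_true] at hm
    omega

/-! ### Weights -/

/-- The distance of an integer to `{-1, 0}`. -/
def wdeg (z : ℤ) : ℕ := if 0 ≤ z then z.toNat else (-1 - z).toNat

/-- The degree of a weight: the distance to the vectors with entries in `{-1, 0}`. -/
def deg {n : ℕ} (a : Fin n → ℤ) : ℕ := ∑ i, wdeg (a i)

/-- Only the `i`-th summand changes. The additive form avoids truncated subtraction. -/
theorem deg_add_single {n : ℕ} (a : Fin n → ℤ) (i : Fin n) (z : ℤ) :
    deg (a + Pi.single i z) + wdeg (a i) = deg a + wdeg (a i + z) := by
  rw [deg, deg, ← Finset.add_sum_erase _ _ (Finset.mem_univ i),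
    ← Finset.add_sum_erase _ (fun i => wdeg (a i)) (Finset.mem_univ i)]
  have : ∑ j ∈ Finset.univ.erase i, wdeg ((a + Pi.single i z : Fin n → ℤ) j) =
      ∑ j ∈ Finset.univ.erase i, wdeg (a j) := by
    refine Finset.sum_congr rfl fun j hj => ?_
    simp [Finset.ne_of_mem_erase hj]
  rw [this]
  simp only [Pi.add_apply, Pi.single_eq_same]
  omega

theorem deg_sub_single {n : ℕ} (a : Fin n → ℤ) (i : Fin n) (z : ℤ) :
    deg (a - Pi.single i z) + wdeg (a i) = deg a + wdeg (a i - z) := by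
  rw [sub_eq_add_neg, ← Pi.single_neg, deg_add_single, sub_eq_add_neg]

theorem deg_add_single_le {n : ℕ} (a : Fin n → ℤ) (i : Fin n) :
    deg (a + Pi.single i 1) ≤ deg a + 1 := by
  have := deg_add_single a i 1
  simp only [wdeg] at this
  split_ifs at this <;> omega

theorem deg_sub_single_le {n : ℕ} (a : Fin n → ℤ) (i : Fin n) :
    deg (a - Pi.single i 1) ≤ deg a + 1 := by
  have := deg_sub_single a i 1
  simp only [wdeg] at this
  split_ifs at this <;> omega

theorem exists_shiftVec_of_deg_eq_zero {n : ℕ} {a : Fin n → ℤ} (h : deg a = 0) :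
    ∃ F : Finset (Fin n), a = shiftVec F := by
  refine ⟨Finset.univ.filter fun i => 0 ≤ a i, funext fun i => ?_⟩
  have := (Finset.sum_eq_zero_iff.mp h) i (Finset.mem_univ i)
  simp only [wdeg] at this
  simp only [shiftVec, Finset.mem_filter, Finset.mem_univ, true_and]
  split_ifs at this ⊢ <;> omega

/-- The weights `F - 1 ± c` on which the quotient `gr A / Q_F` lives. -/
def wvec {n : ℕ} (F : Finset (Fin n)) (c : Fin n → ℕ) : Fin n → ℤ :=
  fun i => if i ∈ F then c i else -1 - c i

theorem wvec_zero {n : ℕ} (F : Finset (Fin n)) : wvec F 0 = shiftVec F := by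
  funext i
  simp only [wvec, shiftVec]
  split_ifs <;> simp

theorem wvec_add_single_of_mem {n : ℕ} {F : Finset (Fin n)} {i : Fin n} (hi : i ∈ F)
    (c : Fin n → ℕ) : wvec F (c + Pi.single i 1) = wvec F c + Pi.single i 1 := by
  funext j
  by_cases hj : j = i
  · subst hj
    simp [wvec, hi]
  · simp [wvec, hj]

theorem wvec_add_single_of_notMem {n : ℕ} {F : Finset (Fin n)} {i : Fin n} (hi : i ∉ F)
    (c : Fin n → ℕ) : wvec F (c + Pi.single i 1) = wvec F c - Pi.single i 1 := by
  funext j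
  by_cases hj : j = i
  · subst hj
    simp [wvec, hi]
    ring
  · simp [wvec, hj]

/-- The signs of the entries determine the orthant `F`, and the entries then determine `c`. -/
theorem wvec_injective {n : ℕ} {F F' : Finset (Fin n)} {c c' : Fin n → ℕ}
    (h : wvec F c = wvec F' c') : F = F' ∧ c = c' := by
  have key : ∀ i, (i ∈ F ↔ i ∈ F') ∧ c i = c' i := fun i => by
    have := congrFun h i
    simp only [wvec] at this
    split_ifs at this with h1 h2 h2 <;>
      first | (exfalso; omega) | exact ⟨by simp [h1, h2], by omega⟩
  exact ⟨Finset.ext fun i => (key i).1, funext fun i => (key i).2⟩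

theorem deg_wvec {n : ℕ} (F : Finset (Fin n)) (c : Fin n → ℕ) : deg (wvec F c) = ∑ i, c i := by
  refine Finset.sum_congr rfl fun i _ => ?_
  simp only [wvec, wdeg]
  split_ifs <;> omega

/-! ### Independence of weight spaces and the projections onto them -/

section Modules

variable {k : Type*} [Field k] {n : ℕ} {N : Type*} [AddCommGroup N] [Module k N]
    [Module (WeylAlgebra k n) N] [IsScalarTower k (WeylAlgebra k n) N]

/-- Together with `x_d_smul`, this is why `x_i` and `∂_i` are mutually inverse up to a nonzero
scalar, except between `a_i = -1` and `a_i = 0`. -/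
theorem d_x_smul {a : Fin n → ℤ} {y : N} (hy : y ∈ wt k n N a) (i : Fin n) :
    d k n i • x k n i • y = (a i + 1) • y := by
  rw [← mul_smul, d_mul_x, if_pos rfl, add_smul, hy i, one_smul, add_smul, one_smul]

theorem x_d_smul {a : Fin n → ℤ} {y : N} (hy : y ∈ wt k n N a) (i : Fin n) :
    x k n i • d k n i • y = a i • y := by
  rw [← mul_smul, hy i]

variable (k n N) in
-- The operators `x_i ∂_i` commute, so their simultaneous generalized eigenspaces are independent.
-- Characteristic zero keeps distinct integer weights distinct in `k`.
theorem iSupIndep_wt [CharZero k] : iSupIndep (wt k n N) := by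
  let θ : Fin n → Module.End k N := fun i => Algebra.lsmul k k N (x k n i * d k n i)
  have hcomm : ∀ i j, Commute (θ i) (θ j) := by
    intro i j
    by_cases hij : i = j
    · rw [hij]
    refine Commute.map ?_ (Algebra.lsmul k k N)
    have hxd : ∀ {i j}, i ≠ j → Commute (d k n i) (x k n j) := fun hij => by
      rw [commute_iff_eq, d_mul_x, if_neg hij, add_zero]
    exact Commute.mul_left
      ((show Commute (x k n i) (x k n j) from x_mul_x k n i j).mul_right (hxd (Ne.symm hij)).symm)
      ((hxd hij).mul_right (d_mul_d k n i j))
  have h := Module.End.independent_iInf_maxGenEigenspace_of_forall_mapsTo θ fun i j φ =>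
    Module.End.mapsTo_maxGenEigenspace_of_comm (hcomm j i) φ
  have hinj : Function.Injective fun (a : Fin n → ℤ) (i : Fin n) => (a i : k) :=
    fun a b hab => funext fun i => Int.cast_injective (congrFun hab i)
  refine (h.comp hinj).mono fun a y hy => ?_
  simp only [Function.comp, Submodule.mem_iInf]
  intro i
  refine Module.End.genEigenspace_le_maximal _ _ 1 ?_
  refine Module.End.mem_genEigenspace_one.mpr ?_
  rw [Int.cast_smul_eq_zsmul]
  exact hy i

theorem isInternal_wt [CharZero k] (hN : ⨆ a, wt k n N a = ⊤) :
    DirectSum.IsInternal (wt k n N) :=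
  DirectSum.isInternal_submodule_of_iSupIndep_of_iSup_eq_top (iSupIndep_wt k n N) hN

/-- The projection onto a weight space. -/
def wtProj [CharZero k] (hN : ⨆ a, wt k n N a = ⊤) (a : Fin n → ℤ) : N →ₗ[k] N :=
  (wt k n N a).subtype ∘ₗ DirectSum.component k _ _ a ∘ₗ
    (LinearEquiv.ofBijective (DirectSum.coeLinearMap (wt k n N)) (isInternal_wt hN)).symm.toLinearMap

theorem wtProj_apply [CharZero k] (hN : ⨆ a, wt k n N a = ⊤) {a b : Fin n → ℤ} {y : N}
    (hy : y ∈ wt k n N b) : wtProj hN a y = if b = a then y else 0 := by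
  split_ifs with h
  · subst h
    exact congrArg Subtype.val ((isInternal_wt hN).ofBijective_coeLinearMap_of_mem hy)
  · exact congrArg Subtype.val ((isInternal_wt hN).ofBijective_coeLinearMap_of_mem_ne h hy)

/-! ### The canonical filtration -/

/-- The span of the weight spaces of degree at most `i`. -/
def canonΓ (k : Type*) [Field k] (n : ℕ) (N : Type*) [AddCommGroup N] [Module k N]
    [Module (WeylAlgebra k n) N] [IsScalarTower k (WeylAlgebra k n) N] (i : ℕ) : Submodule k N :=
  ⨆ a : {a : Fin n → ℤ // deg a ≤ i}, wt k n N a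

theorem wt_le_canonΓ {i : ℕ} {a : Fin n → ℤ} (h : deg a ≤ i) : wt k n N a ≤ canonΓ k n N i :=
  le_iSup (fun a : {a : Fin n → ℤ // deg a ≤ i} => wt k n N a) ⟨a, h⟩

theorem canonΓ_mono : Monotone (canonΓ k n N) := fun _ _ hij =>
  iSup_le fun a => wt_le_canonΓ (a.2.trans hij)

theorem gens_smul_canonΓ {j : ℕ} {v : WeylAlgebra k n} (hv : v ∈ gens k n) {y : N}
    (hy : y ∈ canonΓ k n N j) : v • y ∈ canonΓ k n N (j + 1) := by
  induction hv using Submodule.span_induction with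
  | zero => simp
  | add u v _ _ h h' => rw [add_smul]; exact add_mem h h'
  | smul c v _ h => rw [smul_assoc]; exact Submodule.smul_mem _ c h
  | mem v hv =>
    induction hy using Submodule.iSup_induction' with
    | zero => simp
    | add y z _ _ h h' => rw [smul_add]; exact add_mem h h'
    | mem a y hy =>
      rcases hv with hv | ⟨l, rfl⟩ | ⟨l, rfl⟩
      · obtain rfl : v = 1 := hv
        rw [one_smul]
        exact wt_le_canonΓ (a.2.trans (Nat.le_succ j)) hy
      · exact wt_le_canonΓ ((deg_add_single_le _ l).trans (by have := a.2; omega))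
          (x_smul_mem_wt hy l)
      · exact wt_le_canonΓ ((deg_sub_single_le _ l).trans (by have := a.2; omega))
          (d_smul_mem_wt hy l)

theorem gens_pow_smul_canonΓ (i j : ℕ) {v : WeylAlgebra k n} (hv : v ∈ gens k n ^ i) {y : N}
    (hy : y ∈ canonΓ k n N j) : v • y ∈ canonΓ k n N (i + j) := by
  induction i generalizing v with
  | zero =>
    rw [pow_zero, Submodule.mem_one] at hv
    obtain ⟨c, rfl⟩ := hv
    rw [algebraMap_smul, zero_add]
    exact Submodule.smul_mem _ c hy
  | succ i ih =>
    rw [pow_succ'] at hv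
    induction hv using Submodule.mul_induction_on' with
    | mem_mul_mem u hu v hv =>
      rw [mul_smul, show i + 1 + j = i + j + 1 by omega]
      exact gens_smul_canonΓ hu (ih hv)
    | add u _ v _ h h' => rw [add_smul]; exact add_mem h h'

/-- The filtration of a module which is the sum of its weight spaces by the degree of weights. -/
def canon (hN : ⨆ a, wt k n N a = ⊤) : ModFiltration k n N where
  Γ := canonΓ k n N
  mono := canonΓ_mono
  exhaustive y := by
    have hy : y ∈ ⨆ a, wt k n N a := hN ▸ Submodule.mem_top
    induction hy using Submodule.iSup_induction' with
    | mem a y hy => exact ⟨deg a, wt_le_canonΓ le_rfl hy⟩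
    | zero => exact ⟨0, zero_mem _⟩
    | add y z _ _ h h' =>
      obtain ⟨i, hi⟩ := h
      obtain ⟨j, hj⟩ := h'
      exact ⟨max i j, add_mem (canonΓ_mono (le_max_left i j) hi)
        (canonΓ_mono (le_max_right i j) hj)⟩
  smul_mem i j a ha y hy := by
    rw [bernstein_eq_gens_pow] at ha
    exact gens_pow_smul_canonΓ i j ha hy

theorem wt_le_canon (hN : ⨆ a, wt k n N a = ⊤) {i : ℕ} {a : Fin n → ℤ} (h : deg a ≤ i) :
    wt k n N a ≤ (canon hN).Γ i :=
  wt_le_canonΓ h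

/-- The symbol of a weight vector in the canonical filtration. -/
def wtSymb (hN : ⨆ a, wt k n N a = ⊤) (a : Fin n → ℤ) : wt k n N a →ₗ[k] (canon hN).Gr :=
  symb (canon hN).Γ (deg a) ∘ₗ Submodule.inclusion (wt_le_canon hN le_rfl)

theorem wtSymb_apply (hN : ⨆ a, wt k n N a = ⊤) {a : Fin n → ℤ} {y : N} (hy : y ∈ wt k n N a) :
    wtSymb hN a ⟨y, hy⟩ = symb (canon hN).Γ (deg a) ⟨y, wt_le_canon hN le_rfl hy⟩ := rfl

theorem wtSymb_congr (hN : ⨆ a, wt k n N a = ⊤) {a b : Fin n → ℤ} (h : a = b) {y : N}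
    (hy : y ∈ wt k n N a) : wtSymb hN a ⟨y, hy⟩ = wtSymb hN b ⟨y, h ▸ hy⟩ := by
  subst h
  rfl

theorem xBar_smul_wtSymb (hN : ⨆ a, wt k n N a = ⊤) {a : Fin n → ℤ} {y : N}
    (hy : y ∈ wt k n N a) (i : Fin n) (ha : deg (a + Pi.single i 1) = deg a + 1) :
    xBar k n i • wtSymb hN a ⟨y, hy⟩ =
      wtSymb hN (a + Pi.single i 1) ⟨x k n i • y, x_smul_mem_wt hy i⟩ := by
  rw [wtSymb_apply, wtSymb_apply, xBar_eq_symb, ModFiltration.symb_smul_symb]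
  exact symb_congr (by omega) _ _ rfl

theorem dBar_smul_wtSymb (hN : ⨆ a, wt k n N a = ⊤) {a : Fin n → ℤ} {y : N}
    (hy : y ∈ wt k n N a) (i : Fin n) (ha : deg (a - Pi.single i 1) = deg a + 1) :
    dBar k n i • wtSymb hN a ⟨y, hy⟩ =
      wtSymb hN (a - Pi.single i 1) ⟨d k n i • y, d_smul_mem_wt hy i⟩ := by
  rw [wtSymb_apply, wtSymb_apply, dBar_eq_symb, ModFiltration.symb_smul_symb]
  exact symb_congr (by omega) _ _ rfl

/-- The product is a symbol in degree `deg a + 1`, while its representative `x_i y` already lies in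
level `deg a`. -/
theorem xBar_smul_wtSymb_eq_zero (hN : ⨆ a, wt k n N a = ⊤) {a : Fin n → ℤ} {y : N}
    (hy : y ∈ wt k n N a) (i : Fin n) (ha : deg (a + Pi.single i 1) ≤ deg a) :
    xBar k n i • wtSymb hN a ⟨y, hy⟩ = 0 := by
  rw [wtSymb_apply, xBar_eq_symb, ModFiltration.symb_smul_symb, symb_eq_zero_iff, add_comm]
  exact wt_le_canonΓ ha (x_smul_mem_wt hy i)

theorem dBar_smul_wtSymb_eq_zero (hN : ⨆ a, wt k n N a = ⊤) {a : Fin n → ℤ} {y : N}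
    (hy : y ∈ wt k n N a) (i : Fin n) (ha : deg (a - Pi.single i 1) ≤ deg a) :
    dBar k n i • wtSymb hN a ⟨y, hy⟩ = 0 := by
  rw [wtSymb_apply, dBar_eq_symb, ModFiltration.symb_smul_symb, symb_eq_zero_iff, add_comm]
  exact wt_le_canonΓ ha (d_smul_mem_wt hy i)

/-- At the corner `F - 1`, `x_i` with `i ∉ F` moves an entry from `-1` to `0` and `∂_i` with `i ∈ F`
moves one from `0` to `-1`. The degree stays `0`, so the symbols in degree one vanish. -/
theorem idealQ_le_ker (hN : ⨆ a, wt k n N a = ⊤) (F : Finset (Fin n))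
    (w : wt k n N (shiftVec F)) : idealQ k n F ≤ LinearMap.ker
      (LinearMap.toSpanSingleton (Gr k n) (canon hN).Gr (wtSymb hN (shiftVec F) w)) := by
  refine sup_le (Ideal.span_le.mpr ?_) (Ideal.span_le.mpr ?_)
  · rintro _ ⟨i, hi, rfl⟩
    refine xBar_smul_wtSymb_eq_zero hN w.2 i ?_
    have := deg_add_single (shiftVec F) i 1
    have hi' : i ∉ F := hi
    simp only [shiftVec, hi', wdeg, if_false] at this
    simp at this
    exact this.le
  · rintro _ ⟨i, hi, rfl⟩
    refine dBar_smul_wtSymb_eq_zero hN w.2 i ?_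
    have := deg_sub_single (shiftVec F) i 1
    have hi' : i ∈ F := hi
    simp only [shiftVec, hi', wdeg, if_true] at this
    simp at this
    exact this.le

theorem idealQ_smul_wtSymb (hN : ⨆ a, wt k n N a = ⊤) (F : Finset (Fin n))
    (w : wt k n N (shiftVec F)) {q : Gr k n} (hq : q ∈ idealQ k n F) :
    q • wtSymb hN (shiftVec F) w = 0 :=
  idealQ_le_ker hN F w hq

/-- The associated graded module of the canonical filtration is generated by the weight spaces
of degree zero. -/
theorem wtSymb_mem_of_forall [CharZero k] (hN : ⨆ a, wt k n N a = ⊤)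
    (P : Submodule (Gr k n) (canon hN).Gr) (hP : ∀ F w, wtSymb hN (shiftVec F) w ∈ P)
    (a : Fin n → ℤ) (w : wt k n N a) : wtSymb hN a w ∈ P := by
  induction hm : deg a generalizing a with
  | zero =>
    obtain ⟨F, rfl⟩ := exists_shiftVec_of_deg_eq_zero hm
    exact hP F w
  | succ m ih =>
    obtain ⟨y, hy⟩ := w
    obtain ⟨i, -, hi⟩ : ∃ i ∈ Finset.univ, wdeg (a i) ≠ 0 := by
      by_contra! h
      rw [deg, Finset.sum_eq_zero h] at hm
      omega
    by_cases hpos : 0 ≤ a i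
    -- Here `a_i > 0`, and `y = x_i (a_i⁻¹ ∂_i y)` with `∂_i y` one step closer to the cube.
    · have h1 := deg_sub_single a i 1
      have hai : 0 < a i := by simp only [wdeg] at hi; split_ifs at hi; omega
      have hdeg : deg (a - Pi.single i 1) = m := by
        simp only [wdeg] at h1
        split_ifs at h1 <;> omega
      have hk : (a i : k) ≠ 0 := by exact_mod_cast hai.ne'
      have h2 := P.smul_mem (xBar k n i) (ih _ ⟨(a i : k)⁻¹ • d k n i • y,
        Submodule.smul_mem _ _ (d_smul_mem_wt hy i)⟩ hdeg)
      rw [xBar_smul_wtSymb _ _ _ (by rw [sub_add_cancel]; omega), wtSymb_congr hN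
        (sub_add_cancel a _)] at h2
      convert h2
      rw [smul_comm, x_d_smul hy, ← Int.cast_smul_eq_zsmul k, inv_smul_smul₀ hk]
    -- Here `a_i < -1`, and `y = ∂_i ((a_i + 1)⁻¹ x_i y)` with `x_i y` one step closer to the cube.
    · have h1 := deg_add_single a i 1
      have hai : a i + 1 < 0 := by simp only [wdeg] at hi; split_ifs at hi; omega
      have hdeg : deg (a + Pi.single i 1) = m := by
        simp only [wdeg] at h1
        split_ifs at h1 <;> omega
      have hk : ((a i + 1 : ℤ) : k) ≠ 0 := by exact_mod_cast hai.ne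
      have h2 := P.smul_mem (dBar k n i) (ih _ ⟨((a i + 1 : ℤ) : k)⁻¹ • x k n i • y,
        Submodule.smul_mem _ _ (x_smul_mem_wt hy i)⟩ hdeg)
      rw [dBar_smul_wtSymb _ _ _ (by rw [add_sub_cancel_right]; omega), wtSymb_congr hN
        (add_sub_cancel_right a _)] at h2
      convert h2
      rw [smul_comm, d_x_smul hy, ← Int.cast_smul_eq_zsmul k, inv_smul_smul₀ hk]

theorem eq_top_of_forall_wtSymb_mem [CharZero k] (hN : ⨆ a, wt k n N a = ⊤)
    (P : Submodule (Gr k n) (canon hN).Gr) (hP : ∀ F w, wtSymb hN (shiftVec F) w ∈ P) :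
    P = ⊤ := by
  rw [eq_top_iff]
  rintro z -
  induction z using gr_induction with
  | h0 => exact zero_mem _
  | ha z z' h h' => exact add_mem h h'
  | hs i y hy =>
    suffices ∃ z ∈ P, z = symb (canon hN).Γ i ⟨y, hy⟩ by
      obtain ⟨z, hz, h⟩ := this
      exact h ▸ hz
    have h : y ∈ canonΓ k n N i := hy
    rw [canonΓ] at h
    induction h using Submodule.iSup_induction' with
    | zero => exact ⟨0, zero_mem _, (map_zero _).symm⟩
    | add u v hu hv h h' =>
      obtain ⟨z, hz, e⟩ := h hu
      obtain ⟨z', hz', e'⟩ := h' hv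
      exact ⟨z + z', add_mem hz hz', by rw [e, e']; exact (map_add _ _ _).symm⟩
    | mem a y hm =>
      obtain ⟨a, ha⟩ := a
      -- Weight vectors of degree below `i` have zero symbol in degree `i`; those of degree exactly
      -- `i` give `wtSymb`.
      rcases ha.lt_or_eq with hlt | rfl
      · refine ⟨0, zero_mem _, ((symb_eq_zero_iff _ _).mpr ?_).symm⟩
        rcases i with _ | i
        · omega
        · exact wt_le_canonΓ (Nat.lt_succ_iff.mp hlt) hm
      · exact ⟨_, wtSymb_mem_of_forall hN P hP a ⟨y, hm⟩, rfl⟩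

/-! ### Coefficients of symbols -/

/-- The weight `a` component of the degree `deg a` part of the associated graded module. -/
def grProj [CharZero k] (hN : ⨆ a, wt k n N a = ⊤) (a : Fin n → ℤ) : (canon hN).Gr →ₗ[k] N :=
  DirectSum.toModule k ℕ N fun i =>
    ((filtPrev (canonΓ k n N) i).submoduleOf (canonΓ k n N i)).liftQ
      ((if deg a = i then wtProj hN a else 0) ∘ₗ (canonΓ k n N i).subtype) (by
        rintro ⟨y, hy'⟩ hy
        replace hy : y ∈ filtPrev (canonΓ k n N) i := hy
        change (if deg a = i then wtProj hN a else 0) y = 0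
        clear hy'
        split_ifs with h
        · subst h
          rcases hd : deg a with _ | m
          · rw [hd] at hy
            obtain rfl : y = 0 := hy
            exact map_zero _
          · rw [hd] at hy
            replace hy : y ∈ canonΓ k n N m := hy
            rw [canonΓ] at hy
            induction hy using Submodule.iSup_induction' with
            | zero => exact map_zero _
            | add u v _ _ h h' => rw [map_add, h, h', add_zero]
            | mem b y hm =>
              -- A weight of degree at most `m` differs from `a`, which has degree `m + 1`.
              rw [wtProj_apply hN hm, if_neg]
              rintro rfl
              have := b.2
              omega
        · rfl)

theorem grProj_wtSymb [CharZero k] (hN : ⨆ a, wt k n N a = ⊤) (a b : Fin n → ℤ)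
    (w : wt k n N b) : grProj hN a (wtSymb hN b w) = if b = a then (w : N) else 0 := by
  have h : grProj hN a (wtSymb hN b w) = (if deg a = deg b then wtProj hN a else 0) (w : N) :=
    DirectSum.toModule_lof _ _ _
  rw [h]
  split_ifs with h1 h2 h2
  · rw [wtProj_apply hN w.2, if_pos h2]
  · rw [wtProj_apply hN w.2, if_neg h2]
  · exact absurd (by rw [h2]) h1
  · rfl

/-! ### Monomials attached to a subset -/

/-- The generators acting injectively: `x_i` for `i ∈ F` and `∂_i` for `i ∉ F`. -/
def yGen (k : Type*) [Field k] {n : ℕ} (F : Finset (Fin n)) (i : Fin n) : WeylAlgebra k n :=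
  if i ∈ F then x k n i else d k n i

/-- The classes of the elements `yGen` in degree one of `gr A`. -/
def yBar (k : Type*) [Field k] {n : ℕ} (F : Finset (Fin n)) (i : Fin n) : Gr k n :=
  if i ∈ F then xBar k n i else dBar k n i

/-- The ordered monomials in the elements `yGen`. -/
def yPow (k : Type*) [Field k] {n : ℕ} (F : Finset (Fin n)) (c : Fin n → ℕ) : WeylAlgebra k n :=
  ((List.finRange n).map fun i => yGen k F i ^ c i).prod

/-- For each index only one of `x_i`, `∂_i` is chosen, so the noncommuting pair never occurs. -/
theorem yGen_comm (F : Finset (Fin n)) (i j : Fin n) :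
    yGen k F i * yGen k F j = yGen k F j * yGen k F i := by
  have hxd : ∀ {i j}, i ≠ j → d k n i * x k n j = x k n j * d k n i := fun hij => by
    rw [d_mul_x, if_neg hij, add_zero]
  simp only [yGen]
  split_ifs with h1 h2 h2
  · exact x_mul_x k n i j
  · exact (hxd (by rintro rfl; exact h2 h1)).symm
  · exact hxd (by rintro rfl; exact h1 h2)
  · exact d_mul_d k n i j

theorem yPow_zero (F : Finset (Fin n)) : yPow k F 0 = 1 := by
  simp [yPow]

theorem yPow_add_single (F : Finset (Fin n)) (c : Fin n → ℕ) (i : Fin n) :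
    yPow k F (c + Pi.single i 1) = yGen k F i * yPow k F c := by
  have := list_prod_add_single n (yGen k F) (yGen_comm F) c i _ (List.nodup_finRange n)
  simpa [yPow] using this

theorem yGen_smul_mem_wt {F : Finset (Fin n)} {c : Fin n → ℕ} {y : N}
    (hy : y ∈ wt k n N (wvec F c)) (i : Fin n) :
    yGen k F i • y ∈ wt k n N (wvec F (c + Pi.single i 1)) := by
  by_cases hi : i ∈ F
  · rw [wvec_add_single_of_mem hi, yGen, if_pos hi]
    exact x_smul_mem_wt hy i
  · rw [wvec_add_single_of_notMem hi, yGen, if_neg hi]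
    exact d_smul_mem_wt hy i

theorem yPow_smul_mem_wt {F : Finset (Fin n)} {w : N} (hw : w ∈ wt k n N (shiftVec F))
    (c : Fin n → ℕ) : yPow k F c • w ∈ wt k n N (wvec F c) := by
  induction c using natVec_induction with
  | zero => rwa [yPow_zero, one_smul, wvec_zero]
  | add_single c i ih =>
    rw [yPow_add_single, mul_smul]
    exact yGen_smul_mem_wt ih i

/-- The generator moves away from the wall, and its partner brings `y` back times `c_i + 1` or `-1 -
c_i`, neither of which vanishes in characteristic zero. -/
theorem yGen_smul_eq_zero [CharZero k] {F : Finset (Fin n)} {c : Fin n → ℕ} {y : N}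
    (hy : y ∈ wt k n N (wvec F c)) (i : Fin n) (h : yGen k F i • y = 0) : y = 0 := by
  by_cases hi : i ∈ F
  · rw [yGen, if_pos hi] at h
    have := d_x_smul hy i
    rw [h, smul_zero, ← Int.cast_smul_eq_zsmul k, eq_comm, smul_eq_zero] at this
    refine this.resolve_left ?_
    refine Int.cast_ne_zero.mpr ?_
    simp only [wvec, hi, if_true]
    omega
  · rw [yGen, if_neg hi] at h
    have := x_d_smul hy i
    rw [h, smul_zero, ← Int.cast_smul_eq_zsmul k, eq_comm, smul_eq_zero] at this
    refine this.resolve_left ?_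
    refine Int.cast_ne_zero.mpr ?_
    simp only [wvec, hi, if_false]
    omega

theorem yPow_smul_eq_zero [CharZero k] {F : Finset (Fin n)} {w : N}
    (hw : w ∈ wt k n N (shiftVec F)) (c : Fin n → ℕ) (h : yPow k F c • w = 0) : w = 0 := by
  induction c using natVec_induction with
  | zero => rwa [yPow_zero, one_smul] at h
  | add_single c i ih =>
    rw [yPow_add_single, mul_smul] at h
    exact ih (yGen_smul_eq_zero (yPow_smul_mem_wt hw c) i h)

theorem yBar_smul_wtSymb (hN : ⨆ a, wt k n N a = ⊤) {F : Finset (Fin n)} {c : Fin n → ℕ} {y : N}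
    (hy : y ∈ wt k n N (wvec F c)) (i : Fin n) :
    yBar k F i • wtSymb hN (wvec F c) ⟨y, hy⟩ =
      wtSymb hN (wvec F (c + Pi.single i 1)) ⟨yGen k F i • y, yGen_smul_mem_wt hy i⟩ := by
  have hd : deg (wvec F (c + Pi.single i 1)) = deg (wvec F c) + 1 := by
    simp [deg_wvec, Finset.sum_add_distrib]
  by_cases hi : i ∈ F
  · simp only [yBar, yGen, hi, if_true]
    have e := wvec_add_single_of_mem hi c
    rw [xBar_smul_wtSymb _ _ _ (by rw [← e, hd]), wtSymb_congr hN e.symm]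
  · simp only [yBar, yGen, hi, if_false]
    have e := wvec_add_single_of_notMem hi c
    rw [dBar_smul_wtSymb _ _ _ (by rw [← e, hd]), wtSymb_congr hN e.symm]

/-- The polynomial ring in the `yBar`, as a subring of `gr A`. -/
def polyY (k : Type*) [Field k] {n : ℕ} (F : Finset (Fin n)) :
    MvPolynomial (Fin n) k →ₐ[k] Gr k n :=
  MvPolynomial.aeval (yBar k F)

theorem polyY_monomial_smul (hN : ⨆ a, wt k n N a = ⊤) {F : Finset (Fin n)} {w : N}
    (hw : w ∈ wt k n N (shiftVec F)) (c : Fin n → ℕ) :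
    polyY k F (MvPolynomial.monomial (Finsupp.equivFunOnFinite.symm c) 1) •
      wtSymb hN (shiftVec F) ⟨w, hw⟩ =
      wtSymb hN (wvec F c) ⟨yPow k F c • w, yPow_smul_mem_wt hw c⟩ := by
  induction c using natVec_induction with
  | zero =>
    have h0 : (Finsupp.equivFunOnFinite.symm (0 : Fin n → ℕ)) = 0 := by ext; simp
    rw [h0, MvPolynomial.monomial_zero', map_one, map_one, one_smul,
      wtSymb_congr hN (wvec_zero F).symm]
    congr 2
    rw [yPow_zero, one_smul]
  | add_single c i ih =>
    have h1 : (Finsupp.equivFunOnFinite.symm (c + Pi.single i 1 : Fin n → ℕ)) =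
        Finsupp.single i 1 + Finsupp.equivFunOnFinite.symm c := by
      ext j
      simp [Finsupp.single_apply, Pi.single_apply, add_comm, eq_comm]
    rw [h1, ← one_mul (1 : k), ← MvPolynomial.monomial_mul, map_mul, mul_smul, ih]
    rw [show (MvPolynomial.monomial (Finsupp.single i 1) (1 : k)) = MvPolynomial.X i from rfl,
      polyY, MvPolynomial.aeval_X, yBar_smul_wtSymb]
    congr 2
    rw [yPow_add_single, mul_smul]

/-- Distinct monomials land in distinct weights `wvec F c`, so projecting to one weight extracts one
coefficient. -/
theorem grProj_polyY_smul [CharZero k] (hN : ⨆ a, wt k n N a = ⊤) {F : Finset (Fin n)}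
    (w : wt k n N (shiftVec F)) (p : MvPolynomial (Fin n) k) (F' : Finset (Fin n))
    (c : Fin n → ℕ) :
    grProj hN (wvec F' c) (polyY k F p • wtSymb hN (shiftVec F) w) =
      if F = F' then p.coeff (Finsupp.equivFunOnFinite.symm c) • yPow k F c • (w : N) else 0 := by
  induction p using MvPolynomial.induction_on' with
  | add p q hp hq =>
    rw [map_add, add_smul, map_add, hp, hq]
    split_ifs
    · rw [MvPolynomial.coeff_add, add_smul]
    · rw [add_zero]
  | monomial m r =>
    obtain ⟨e, rfl⟩ := Finsupp.equivFunOnFinite.symm.surjective m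
    have h1 : MvPolynomial.monomial (Finsupp.equivFunOnFinite.symm e) r =
        r • MvPolynomial.monomial (Finsupp.equivFunOnFinite.symm e) 1 := by
      rw [MvPolynomial.smul_monomial, smul_eq_mul, mul_one]
    rw [h1, map_smul (polyY k F), smul_assoc, map_smul (grProj hN _), polyY_monomial_smul hN w.2, grProj_wtSymb,
      MvPolynomial.coeff_smul, MvPolynomial.coeff_monomial]
    by_cases hF : F = F'
    · subst hF
      by_cases hc : e = c
      · subst hc
        simp
      · rw [if_neg fun h => hc (wvec_injective h).2, if_pos rfl,
          if_neg fun h => hc (Finsupp.equivFunOnFinite.symm.injective h)]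
        simp
    · rw [if_neg fun h => hF (wvec_injective h).1, if_neg hF, smul_zero]

end Modules

end WeylAlgebra

namespace WeylAlgebra

/-! ### Reduction modulo `Q_F` and freeness of the action -/

section Modules

variable {k : Type*} [Field k] {n : ℕ} {N : Type*} [AddCommGroup N] [Module k N]
    [Module (WeylAlgebra k n) N] [IsScalarTower k (WeylAlgebra k n) N]

/-- Each generator of `gr A` is either some `yBar` or an element of `Q_F`, so the polynomials in the
`yBar` map onto `gr A / Q_F`. -/
theorem exists_sub_polyY_mem (F : Finset (Fin n)) (r : Gr k n) :
    ∃ p, r - polyY k F p ∈ idealQ k n F := by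
  have hr : r ∈ Algebra.adjoin k (Set.range (xBar k n) ∪ Set.range (dBar k n)) := by
    rw [adjoin_gr]
    trivial
  induction hr using Algebra.adjoin_induction with
  | algebraMap c => exact ⟨MvPolynomial.C c, by simp [polyY]⟩
  | add r s _ _ hr hs =>
    obtain ⟨p, hp⟩ := hr
    obtain ⟨q, hq⟩ := hs
    refine ⟨p + q, ?_⟩
    rw [map_add, add_sub_add_comm]
    exact add_mem hp hq
  | mul r s _ _ hr hs =>
    obtain ⟨p, hp⟩ := hr
    obtain ⟨q, hq⟩ := hs
    refine ⟨p * q, ?_⟩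
    have : r * s - polyY k F (p * q) = s * (r - polyY k F p) + polyY k F p * (s - polyY k F q) := by
      rw [map_mul]
      ring
    rw [this]
    exact add_mem (Ideal.mul_mem_left _ _ hp) (Ideal.mul_mem_left _ _ hq)
  | mem r hr =>
    rcases hr with ⟨i, rfl⟩ | ⟨i, rfl⟩
    · by_cases hi : i ∈ F
      · refine ⟨MvPolynomial.X i, ?_⟩
        rw [polyY, MvPolynomial.aeval_X, yBar, if_pos hi, sub_self]
        exact zero_mem _
      · refine ⟨0, ?_⟩
        rw [map_zero, sub_zero]
        exact le_sup_left (α := Ideal (Gr k n)) (Ideal.subset_span ⟨i, hi, rfl⟩)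
    · by_cases hi : i ∈ F
      · refine ⟨0, ?_⟩
        rw [map_zero, sub_zero]
        exact le_sup_right (α := Ideal (Gr k n)) (Ideal.subset_span ⟨i, hi, rfl⟩)
      · refine ⟨MvPolynomial.X i, ?_⟩
        rw [polyY, MvPolynomial.aeval_X, yBar, if_neg hi, sub_self]
        exact zero_mem _

/-- Monomials in the `yBar` are independent on symbols of independent weight vectors. -/
theorem eq_zero_of_sum_polyY_smul_eq_zero [CharZero k] (hN : ⨆ a, wt k n N a = ⊤)
    {ι : Type*} [Fintype ι] (φ : ι → Finset (Fin n)) (w : ∀ s, wt k n N (shiftVec (φ s)))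
    (hw : ∀ F, ∀ c : ι → k, (∀ s, φ s ≠ F → c s = 0) → ∑ s, c s • (w s : N) = 0 → ∀ s, c s = 0)
    (p : ι → MvPolynomial (Fin n) k)
    (h : ∑ s, polyY k (φ s) (p s) • wtSymb hN (shiftVec (φ s)) (w s) = 0) (s : ι) : p s = 0 := by
  ext m
  obtain ⟨c, rfl⟩ := Finsupp.equivFunOnFinite.symm.surjective m
  have h1 := congrArg (grProj hN (wvec (φ s) c)) h
  rw [map_zero, map_sum] at h1
  simp_rw [grProj_polyY_smul] at h1
  -- Only indices with the same subset as `s` contribute to a weight in the orthant of `φ s`; `e`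
  -- records their coefficients at `c`.
  let e : ι → k := fun t =>
    if φ t = φ s then (p t).coeff (Finsupp.equivFunOnFinite.symm c) else 0
  have hmem : ∑ t, e t • (w t : N) ∈ wt k n N (shiftVec (φ s)) := by
    refine sum_mem fun t _ => ?_
    simp only [e]
    split_ifs with ht
    · exact Submodule.smul_mem _ _ (ht ▸ (w t).2)
    · rw [zero_smul]
      exact zero_mem _
  -- The common monomial factors out and, acting injectively, can be cancelled.
  have h2 : yPow k (φ s) c • ∑ t, e t • (w t : N) = 0 := by
    rw [← h1, Finset.smul_sum]
    refine Finset.sum_congr rfl fun t _ => ?_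
    simp only [e]
    split_ifs with ht
    · rw [smul_comm, ← ht]
    · simp
  have h3 := hw (φ s) e (fun t ht => if_neg ht) (yPow_smul_eq_zero hmem c h2) s
  simpa [e] using h3

theorem polyY_smul_wtSymb_eq_zero [CharZero k] (hN : ⨆ a, wt k n N a = ⊤) {F : Finset (Fin n)}
    (w : wt k n N (shiftVec F)) (hw : w ≠ 0) {p : MvPolynomial (Fin n) k}
    (h : polyY k F p • wtSymb hN (shiftVec F) w = 0) : p = 0 := by
  refine eq_zero_of_sum_polyY_smul_eq_zero hN (ι := Unit) (fun _ => F) (fun _ => w) ?_ (fun _ => p)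
    (by simpa using h) ()
  intro _ c _ hc _
  have : c () • (w : N) = 0 := by simpa using hc
  exact (smul_eq_zero.mp this).resolve_right fun h => hw (Subtype.ext h)

end Modules

/-! ### The simple modules attached to subsets, and primality of `idealQ` -/

section Fock

open MvPolynomial

variable (k : Type*) [Field k] {n : ℕ} (F : Finset (Fin n))

/-- The operators of the generators of the Weyl algebra on polynomials, where the roles of `x_i` and
`∂_i` are exchanged for `i ∉ F`. -/
def fockGen : Fin n ⊕ Fin n → Module.End k (MvPolynomial (Fin n) k) :=
  Sum.elim
    -- The sign preserves `∂_i x_i - x_i ∂_i = 1` under the exchange.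
    (fun i => if i ∈ F then LinearMap.mulLeft k (X i) else -(pderiv i).toLinearMap)
    (fun i => if i ∈ F then (pderiv i).toLinearMap else LinearMap.mulLeft k (X i))

/-- The commutator of two derivations is a derivation, and this one vanishes on the variables. -/
theorem pderiv_pderiv_comm (i j : Fin n) (p : MvPolynomial (Fin n) k) :
    pderiv i (pderiv j p) = pderiv j (pderiv i p) := by
  have : ⁅pderiv (R := k) i, pderiv (R := k) j⁆ = 0 := by
    refine MvPolynomial.derivation_ext fun l => ?_
    simp only [Derivation.commutator_apply, pderiv_X, Pi.single_apply]
    split_ifs <;> simp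
  have h := DFunLike.congr_fun this p
  rw [Derivation.commutator_apply] at h
  exact sub_eq_zero.mp h

theorem fockGen_rel {a b : FreeAlgebra k (Fin n ⊕ Fin n)} (h : Rel k n a b) :
    FreeAlgebra.lift k (fockGen k F) a = FreeAlgebra.lift k (fockGen k F) b := by
  have hne : ∀ {i j : Fin n}, i ∈ F → j ∉ F → i ≠ j := fun hi hj h => hj (h ▸ hi)
  cases h with
  | x_comm i j =>
    simp only [map_mul, FreeAlgebra.lift_ι_apply, fockGen, Sum.elim_inl]
    refine LinearMap.ext fun p => ?_
    split_ifs with hi hj hj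
    · simp [mul_left_comm]
    · simp [(hne hi hj).symm]
    · simp [(hne hj hi).symm]
    · simp [pderiv_pderiv_comm k i j]
  | d_comm i j =>
    simp only [map_mul, FreeAlgebra.lift_ι_apply, fockGen, Sum.elim_inr]
    refine LinearMap.ext fun p => ?_
    split_ifs with hi hj hj
    · simp [pderiv_pderiv_comm k i j]
    · simp [hne hi hj]
    · simp [hne hj hi]
    · simp [mul_left_comm]
  | d_x i j =>
    by_cases hij : i = j
    · subst hij
      simp only [if_true, map_mul, map_add, map_one, FreeAlgebra.lift_ι_apply, fockGen,
        Sum.elim_inr, Sum.elim_inl]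
      refine LinearMap.ext fun p => ?_
      split_ifs with hi
      · simp
      · simp
    · simp only [hij, if_false, map_mul, map_add, map_zero, FreeAlgebra.lift_ι_apply, fockGen,
        Sum.elim_inr, Sum.elim_inl]
      refine LinearMap.ext fun p => ?_
      split_ifs with hi hj hj
      · simp [Ne.symm hij]
      · simp [pderiv_pderiv_comm k i j]
      · simp [mul_left_comm]
      · simp [hij]

/-- The representation of the Weyl algebra on polynomials given by `fockGen`. -/
def fockRep : WeylAlgebra k n →ₐ[k] Module.End k (MvPolynomial (Fin n) k) :=
  RingQuot.liftAlgHom k ⟨FreeAlgebra.lift k (fockGen k F), fun _ _ h => fockGen_rel k F h⟩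

theorem fockRep_mk (a : FreeAlgebra k (Fin n ⊕ Fin n)) :
    fockRep k F (mk k n a) = FreeAlgebra.lift k (fockGen k F) a :=
  RingQuot.liftAlgHom_mkAlgHom_apply _ _ _ _

/-- The polynomial ring with the action of the Weyl algebra given by `fockRep`. -/
def Fock (k : Type*) [Field k] {n : ℕ} (_ : Finset (Fin n)) : Type _ := MvPolynomial (Fin n) k

instance : AddCommGroup (Fock k F) := inferInstanceAs (AddCommGroup (MvPolynomial (Fin n) k))

instance : Module k (Fock k F) := inferInstanceAs (Module k (MvPolynomial (Fin n) k))

instance : Module (WeylAlgebra k n) (Fock k F) :=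
  Module.compHom (MvPolynomial (Fin n) k) (fockRep k F).toRingHom

instance : IsScalarTower k (WeylAlgebra k n) (Fock k F) :=
  IsScalarTower.of_algebraMap_smul fun c p => by
    change fockRep k F (algebraMap k _ c) p = _
    rw [AlgHom.commutes]
    rfl

/-- This supplies, for every `F`, a module with a nonzero vector of weight `F - 1`, on which `Q_F`
can be tested. -/
theorem one_mem_wt_fock : (1 : MvPolynomial (Fin n) k) ∈ wt k n (Fock k F) (shiftVec F) := by
  intro i
  change fockRep k F (x k n i * d k n i) (1 : MvPolynomial (Fin n) k) =
    shiftVec F i • (1 : MvPolynomial (Fin n) k)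
  rw [map_mul, x, d, fockRep_mk, fockRep_mk, FreeAlgebra.lift_ι_apply, FreeAlgebra.lift_ι_apply]
  by_cases hi : i ∈ F
  · simp [fockGen, hi, shiftVec]
  · simp [fockGen, hi, shiftVec]

end Fock

/-! ### Weight spaces of `M_rat` -/

section RatWeights

variable (k : Type*) [Field k] (n : ℕ) (M : Type*) [AddCommGroup M] [Module k M]
    [Module (WeylAlgebra k n) M] [IsScalarTower k (WeylAlgebra k n) M]

theorem wt_le_rat {a : Fin n → ℤ} {y : M} (hy : y ∈ wt k n M a) : y ∈ rat k n M :=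
  Submodule.mem_iSup_of_mem (p := wt k n M) a hy

/-- The weight spaces of `M_rat` are those of `M`. -/
def wtRatEquiv (a : Fin n → ℤ) : wt k n (rat k n M) a ≃ₗ[k] wt k n M a where
  toFun y := ⟨y.1.1, fun i => congrArg Subtype.val (y.2 i)⟩
  map_add' _ _ := rfl
  map_smul' _ _ := rfl
  invFun y := ⟨⟨y.1, wt_le_rat k n M y.2⟩, fun i => Subtype.ext (y.2 i)⟩
  left_inv _ := rfl
  right_inv _ := rfl

theorem iSup_wt_rat : ⨆ a, wt k n (rat k n M) a = ⊤ := by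
  rw [eq_top_iff]
  rintro ⟨y, hy⟩ -
  have h : y ∈ ⨆ a, wt k n M a := hy
  induction h using Submodule.iSup_induction' with
  | zero => exact zero_mem _
  | mem a y hm => exact Submodule.mem_iSup_of_mem a fun i => Subtype.ext (hm i)
  | add u v hu hv h h' => exact add_mem (h hu) (h' hv)

end RatWeights

/-! ### The `Q_F` are prime and pairwise incomparable -/

section Prime

variable (k : Type*) [Field k] [CharZero k] {n : ℕ} (F : Finset (Fin n))

/-- `Q_F` kills the symbol of `1` in the Fock module, on which polynomials in the `yBar` act freely.
No description of `gr A` as a polynomial ring is needed. Passing to `rat` ensures that the module is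
the sum of its weight spaces. -/
theorem polyY_mem_idealQ_iff {p : MvPolynomial (Fin n) k} :
    polyY k F p ∈ idealQ k n F ↔ p = 0 := by
  refine ⟨fun h => ?_, fun h => by rw [h, map_zero]; exact zero_mem _⟩
  let w := (wtRatEquiv k n (Fock k F) (shiftVec F)).symm ⟨_, one_mem_wt_fock k F⟩
  refine polyY_smul_wtSymb_eq_zero (iSup_wt_rat k n (Fock k F)) w ?_
    (idealQ_smul_wtSymb (iSup_wt_rat k n (Fock k F)) F w h)
  rw [ne_eq, LinearEquiv.map_eq_zero_iff]
  exact fun h => one_ne_zero (α := MvPolynomial (Fin n) k) (congrArg Subtype.val h)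

/-- By `exists_sub_polyY_mem` and `polyY_mem_idealQ_iff`, `gr A / Q_F` is a polynomial ring over
`k`, hence a domain. -/
theorem idealQ_isPrime : (idealQ k n F).IsPrime := by
  refine Ideal.isPrime_iff.mpr ⟨fun h => ?_, fun {r s} hrs => ?_⟩
  · have : polyY k F 1 ∈ idealQ k n F := h ▸ Submodule.mem_top
    rw [polyY_mem_idealQ_iff] at this
    exact one_ne_zero this
  · obtain ⟨p, hp⟩ := exists_sub_polyY_mem F r
    obtain ⟨q, hq⟩ := exists_sub_polyY_mem F s
    have hpq : polyY k F (p * q) ∈ idealQ k n F := by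
      have : polyY k F (p * q) = r * s -
          (s * (r - polyY k F p) + polyY k F p * (s - polyY k F q)) := by
        rw [map_mul]
        ring
      rw [this]
      exact sub_mem hrs (add_mem (Ideal.mul_mem_left _ _ hp) (Ideal.mul_mem_left _ _ hq))
    rw [polyY_mem_idealQ_iff, mul_eq_zero] at hpq
    rcases hpq with rfl | rfl
    · left
      simpa using hp
    · right
      simpa using hq

variable {k F}

theorem yBar_notMem_idealQ (i : Fin n) : yBar k F i ∉ idealQ k n F := by
  have : yBar k F i = polyY k F (MvPolynomial.X i) := by rw [polyY, MvPolynomial.aeval_X]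
  rw [this, polyY_mem_idealQ_iff]
  exact MvPolynomial.X_ne_zero i

/-- If `i` lies in exactly one of `F` and `F'`, the class `yBar k F' i` is among the generators of
`Q_F` but is not in `Q_{F'}`. -/
theorem eq_of_idealQ_le {F' : Finset (Fin n)} (h : idealQ k n F ≤ idealQ k n F') : F = F' := by
  ext i
  by_contra hi
  refine yBar_notMem_idealQ (k := k) (F := F') i (h ?_)
  by_cases hF : i ∈ F
  · have hF' : i ∉ F' := fun h => hi (iff_of_true hF h)
    rw [yBar, if_neg hF']
    exact le_sup_right (α := Ideal (Gr k n)) (Ideal.subset_span ⟨i, hF, rfl⟩)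
  · have hF' : i ∈ F' := by
      by_contra h
      exact hi (iff_of_false hF h)
    rw [yBar, if_pos hF']
    exact le_sup_left (α := Ideal (Gr k n)) (Ideal.subset_span ⟨i, hF, rfl⟩)

end Prime

/-! ### Structure of the associated graded module of the canonical filtration -/

section Structure

/-- Indices for bases of the weight spaces of degree zero. -/
abbrev BasisIndex (k : Type*) [Field k] (n : ℕ) (N : Type*) [AddCommGroup N] [Module k N]
    [Module (WeylAlgebra k n) N] [IsScalarTower k (WeylAlgebra k n) N] : Type :=
  Σ F : Finset (Fin n), Fin (Module.finrank k (wt k n N (shiftVec F)))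

variable {k : Type*} [Field k] [CharZero k] {n : ℕ} {N : Type*} [AddCommGroup N] [Module k N]
    [Module (WeylAlgebra k n) N] [IsScalarTower k (WeylAlgebra k n) N]
    (hN : ⨆ a, wt k n N a = ⊤) 
    [∀ F : Finset (Fin n), FiniteDimensional k (wt k n N (shiftVec F))]

/-- The chosen basis vectors of the weight spaces of degree zero. -/
def basisVec (s : BasisIndex k n N) : wt k n N (shiftVec s.1) :=
  Module.finBasis k (wt k n N (shiftVec s.1)) s.2

/-- The map from `gr A / Q_F` given by the symbol of a vector of weight `F - 1`. -/
def quotMap (F : Finset (Fin n)) (w : wt k n N (shiftVec F)) :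
    (Gr k n ⧸ idealQ k n F) →ₗ[Gr k n] (canon hN).Gr :=
  Submodule.liftQ (idealQ k n F)
    (LinearMap.toSpanSingleton (Gr k n) (canon hN).Gr (wtSymb hN _ w))
    (idealQ_le_ker hN F w)

/-- The map from the sum of copies of the `gr A / Q_F` to the associated graded module. -/
def structMap : (∀ s : BasisIndex k n N, Gr k n ⧸ idealQ k n s.1) →ₗ[Gr k n] (canon hN).Gr :=
  ∑ s : BasisIndex k n N, quotMap hN s.1 (basisVec s) ∘ₗ LinearMap.proj s

omit [CharZero k] in
theorem structMap_mk (r : BasisIndex k n N → Gr k n) :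
    structMap hN (fun s => Ideal.Quotient.mk _ (r s)) =
      ∑ s, r s • wtSymb hN (shiftVec s.1) (basisVec s) := by
  rw [structMap, LinearMap.sum_apply]
  rfl

/-- Every entry is represented by a polynomial in the `yBar`, so a kernel element is a polynomial
relation between symbols of basis vectors, and these are independent. -/
theorem structMap_injective : Function.Injective (structMap hN) := by
  rw [← LinearMap.ker_eq_bot, eq_bot_iff]
  intro z hz
  have hp : ∀ s, ∃ p, Ideal.Quotient.mk (idealQ k n s.1) (polyY k s.1 p) = z s := by
    intro s
    obtain ⟨r, hr⟩ := Ideal.Quotient.mk_surjective (z s)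
    obtain ⟨p, hp⟩ := exists_sub_polyY_mem s.1 r
    exact ⟨p, hr ▸ (Ideal.Quotient.eq.mpr hp).symm⟩
  choose p hp using hp
  have hz' : z = fun s => Ideal.Quotient.mk _ (polyY k s.1 (p s)) := funext fun s => (hp s).symm
  rw [LinearMap.mem_ker, hz', structMap_mk] at hz
  have := eq_zero_of_sum_polyY_smul_eq_zero hN (fun s : BasisIndex k n N => s.1) basisVec ?_ p hz
  · rw [Submodule.mem_bot, hz']
    funext s
    rw [this s, map_zero, map_zero]
    rfl
  · intro F c hc h0 s
    by_cases hs : s.1 = F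
    swap
    · exact hc s hs
    subst hs
    -- Coefficients over other subsets vanish, leaving a linear relation in a single basis.
    have h1 : ∑ j, c ⟨s.1, j⟩ • Module.finBasis k (wt k n N (shiftVec s.1)) j = 0 := by
      apply Subtype.ext
      rw [← Finset.univ_sigma_univ, Finset.sum_sigma, Finset.sum_eq_single s.1] at h0
      · simpa [basisVec] using h0
      · intro F' _ hF'
        refine Finset.sum_eq_zero fun j _ => ?_
        rw [hc ⟨F', j⟩ hF', zero_smul]
      · simp
    exact (Fintype.linearIndependent_iff.mp
      (Module.finBasis k (wt k n N (shiftVec s.1))).linearIndependent) _ h1 s.2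

theorem structMap_surjective : Function.Surjective (structMap hN) := by
  classical
  rw [← LinearMap.range_eq_top]
  refine eq_top_of_forall_wtSymb_mem hN _ fun F w => ?_
  rw [← (Module.finBasis k (wt k n N (shiftVec F))).sum_repr w, map_sum]
  refine sum_mem fun j _ => ?_
  rw [map_smul, ← algebraMap_smul (Gr k n)]
  refine Submodule.smul_mem _ _ ⟨fun s => Ideal.Quotient.mk _ (if s = ⟨F, j⟩ then 1 else 0), ?_⟩
  rw [structMap_mk, Finset.sum_eq_single ⟨F, j⟩]
  · rw [if_pos rfl, one_smul]
    rfl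
  · intro s _ hs
    rw [if_neg hs, zero_smul]
  · simp

/-- The associated graded module of the canonical filtration is a sum of copies of the
`gr A / Q_F`. -/
def structEquiv : (∀ s : BasisIndex k n N, Gr k n ⧸ idealQ k n s.1) ≃ₗ[Gr k n] (canon hN).Gr :=
  LinearEquiv.ofBijective (structMap hN) ⟨structMap_injective hN, structMap_surjective hN⟩

theorem canon_isGood : (canon hN).IsGood :=
  Module.Finite.equiv (structEquiv hN)

end Structure

end WeylAlgebra

/-! ### Local lengths and minimal associated primes -/

section LocalLength

variable {R : Type*} [CommRing R]

/-- Associated primes contain the annihilator, and over a noetherian ring the minimal primes of the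
annihilator of a finite module are associated. -/
theorem Module.minimal_associatedPrimes_iff [IsNoetherianRing R] {X : Type*} [AddCommGroup X]
    [Module R X] [Module.Finite R X] {Q : Ideal R} :
    Minimal (fun P => P ∈ associatedPrimes R X) Q ↔ Q ∈ (Module.annihilator R X).minimalPrimes := by
  have hle : ∀ {P}, P ∈ associatedPrimes R X → Module.annihilator R X ≤ P := fun {P} hP =>
    Submodule.annihilator_top.symm.le.trans (IsAssociatedPrime.annihilator_le hP)
  constructor
  · intro h
    have := h.1.isPrime
    obtain ⟨P, hP, hPQ⟩ := Ideal.exists_minimalPrimes_le (hle h.1)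
    rwa [← h.eq_of_le (Module.associatedPrimes.minimalPrimes_annihilator_subset_associatedPrimes
      R X hP) hPQ]
  · intro h
    exact ⟨Module.associatedPrimes.minimalPrimes_annihilator_subset_associatedPrimes R X h,
      fun P hP hPQ => h.2 ⟨hP.isPrime, hle hP⟩ hPQ⟩

variable (Q : Ideal R) [Q.IsPrime]

theorem LinearEquiv.localLength_eq {X Y : Type*} [AddCommGroup X] [Module R X]
    [AddCommGroup Y] [Module R Y] (e : X ≃ₗ[R] Y) :
    Module.localLength Q X = Module.localLength Q Y :=
  (LinearEquiv.ofBijective (LocalizedModule.map Q.primeCompl e.toLinearMap)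
    ⟨LocalizedModule.map_injective _ _ e.injective,
      LocalizedModule.map_surjective _ _ e.surjective⟩).length_eq

theorem Module.localLength_pi {ι : Type*} [Fintype ι] (X : ι → Type*) [∀ i, AddCommGroup (X i)]
    [∀ i, Module R (X i)] :
    Module.localLength Q (∀ i, X i) = ∑ i, Module.localLength Q (X i) := by
  let f : (∀ i, X i) →ₗ[R] ∀ i, LocalizedModule Q.primeCompl (X i) :=
    .pi fun i => LocalizedModule.mkLinearMap Q.primeCompl (X i) ∘ₗ .proj i
  have : IsLocalizedModule Q.primeCompl f := inferInstance
  let e := (IsLocalizedModule.iso Q.primeCompl f).extendScalarsOfIsLocalization Q.primeCompl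
    (Localization Q.primeCompl)
  rw [Module.localLength, e.length_eq, Module.length_pi_of_fintype]
  rfl

theorem Module.localLength_quotient_ne_zero_iff (I : Ideal R) :
    Module.localLength Q (R ⧸ I) ≠ 0 ↔ I ≤ Q := by
  rw [Module.localLength_ne_zero_iff, Module.support_eq_zeroLocus, Ideal.annihilator_quotient]
  rfl

/-- The localization of `R / Q` at `Q` is the residue field: a nonzero fraction has numerator
outside `Q`, hence generates. -/
theorem Module.localLength_quotient_self : Module.localLength Q (R ⧸ Q) = 1 := by
  rw [Module.localLength, Module.length_eq_one_iff, isSimpleModule_iff_toSpanSingleton_surjective]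
  constructor
  · exact Module.length_pos_iff.mp
      (pos_iff_ne_zero.mpr ((Module.localLength_quotient_ne_zero_iff Q Q).mpr le_rfl))
  · intro z hz w
    induction z using LocalizedModule.induction_on with
    | h m s =>
    induction w using LocalizedModule.induction_on with
    | h m' t =>
    obtain ⟨r, rfl⟩ := Ideal.Quotient.mk_surjective m
    obtain ⟨r', rfl⟩ := Ideal.Quotient.mk_surjective m'
    have hr : r ∈ Q.primeCompl := by
      intro hr
      rw [Ideal.Quotient.eq_zero_iff_mem.mpr hr, LocalizedModule.zero_mk] at hz
      exact hz rfl
    -- This is `r'/t` divided by `r/s`.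
    refine ⟨Localization.mk (s * r') (t * ⟨r, hr⟩), ?_⟩
    rw [LinearMap.toSpanSingleton_apply, LocalizedModule.mk_smul_mk, LocalizedModule.mk_eq]
    refine ⟨1, ?_⟩
    simp only [one_smul, Submonoid.smul_def, Submonoid.coe_mul]
    change Ideal.Quotient.mk Q (t * ((s * r') * r)) = Ideal.Quotient.mk Q ((t * r * s) * r')
    congr 1
    ring

end LocalLength

namespace WeylAlgebra

/-! ### Finite dimensionality of weight spaces -/

section FiniteDimensional

variable {k : Type*} [Field k] {n : ℕ} {N : Type*} [AddCommGroup N] [Module k N]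
    [Module (WeylAlgebra k n) N] [IsScalarTower k (WeylAlgebra k n) N]

theorem xPow_smul_mem_wt (c : Fin n → ℕ) {a : Fin n → ℤ} {y : N} (hy : y ∈ wt k n N a) :
    xPow k n c • y ∈ wt k n N (a + fun i => (c i : ℤ)) := by
  induction c using natVec_induction with
  | zero => simpa [xPow, ← Pi.zero_def] using hy
  | add_single c i ih =>
    rw [← x_mul_xPow, mul_smul]
    convert x_smul_mem_wt ih i using 2
    funext j
    simp [Pi.single_apply, add_assoc]

theorem dPow_smul_mem_wt (c : Fin n → ℕ) {a : Fin n → ℤ} {y : N} (hy : y ∈ wt k n N a) :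
    dPow k n c • y ∈ wt k n N (a - fun i => (c i : ℤ)) := by
  induction c using natVec_induction with
  | zero => simpa [dPow, ← Pi.zero_def] using hy
  | add_single c i ih =>
    rw [← d_mul_dPow, mul_smul]
    convert d_smul_mem_wt ih i using 2
    funext j
    simp [Pi.single_apply, sub_sub]

theorem xPow_dPow_smul (c : Fin n → ℕ) {a : Fin n → ℤ} {y : N} (hy : y ∈ wt k n N a) :
    ∃ l : k, (xPow k n c * dPow k n c) • y = l • y := by
  induction c using natVec_induction with
  | zero => exact ⟨1, by simp [xPow, dPow]⟩
  | add_single c i ih =>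
    obtain ⟨l, hl⟩ := ih
    have hcomm : x k n i * xPow k n c = xPow k n c * x k n i :=
      Commute.list_prod_right _ _ fun z hz => by
        obtain ⟨j, -, rfl⟩ := List.mem_map.mp hz
        exact (show Commute (x k n i) (x k n j) from x_mul_x k n i j).pow_right _
    have h1 := x_d_smul (dPow_smul_mem_wt c hy) i
    rw [← Int.cast_smul_eq_zsmul k] at h1
    -- The new factor `a_i - c_i` is the eigenvalue of `x_i ∂_i` on `∂^c y`.
    refine ⟨((a - fun i => (c i : ℤ)) i : k) * l, ?_⟩
    rw [← x_mul_xPow, ← d_mul_dPow, hcomm, mul_assoc, mul_smul, mul_smul, mul_smul, h1, smul_comm,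
      ← mul_smul (xPow k n c), hl, smul_smul]

/-- The monomial `x^c ∂^e` shifts weights by `c - e`. It returns to weight `a` only if `c = e`, and
then it acts as a scalar. -/
theorem wtProj_smul_mem [CharZero k] (hN : ⨆ a, wt k n N a = ⊤) {a : Fin n → ℤ}
    {W : Submodule k N} (hW : W ≤ wt k n N a) (r : WeylAlgebra k n) {w : N} (hw : w ∈ W) :
    wtProj hN a (r • w) ∈ W := by
  obtain ⟨i, hi⟩ := bernstein_exhaustive k n r
  induction hi using Submodule.span_induction with
  | zero =>
    rw [zero_smul, map_zero]
    exact zero_mem _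
  | add r s _ _ hr hs =>
    rw [add_smul, map_add]
    exact add_mem hr hs
  | smul c r _ hr =>
    rw [smul_assoc, map_smul]
    exact Submodule.smul_mem _ c hr
  | mem r hr =>
    obtain ⟨c, e, -, rfl⟩ := hr
    by_cases hce : c = e
    · subst hce
      obtain ⟨l, hl⟩ := xPow_dPow_smul c (hW hw)
      rw [hl, map_smul, wtProj_apply hN (hW hw), if_pos rfl]
      exact Submodule.smul_mem _ l hw
    · rw [mul_smul, wtProj_apply hN (xPow_smul_mem_wt c (dPow_smul_mem_wt e (hW hw))), if_neg]
      · exact zero_mem _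
      · intro h
        refine hce (funext fun i => ?_)
        have := congrFun h i
        simp only [Pi.add_apply, Pi.sub_apply] at this
        omega

theorem wtProj_span_mem [CharZero k] (hN : ⨆ a, wt k n N a = ⊤) {a : Fin n → ℤ}
    {W : Submodule k N} (hW : W ≤ wt k n N a) {y : N}
    (hy : y ∈ Submodule.span (WeylAlgebra k n) (W : Set N)) : wtProj hN a y ∈ W := by
  -- Quantifying over `r` makes the statement stable under scalar multiplication in the span
  -- induction.
  suffices ∀ r : WeylAlgebra k n, wtProj hN a (r • y) ∈ W by simpa using this 1
  induction hy using Submodule.span_induction with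
  | mem w hw => exact fun r => wtProj_smul_mem hN hW r hw
  | zero =>
    intro r
    rw [smul_zero, map_zero]
    exact zero_mem _
  | add y z _ _ hy hz =>
    intro r
    rw [smul_add, map_add]
    exact add_mem (hy r) (hz r)
  | smul s y _ hy =>
    intro r
    rw [← mul_smul]
    exact hy _

/-- The weight spaces of a noetherian module are finite dimensional. -/
theorem finiteDimensional_wt [CharZero k] (hN : ⨆ a, wt k n N a = ⊤)
    [h : IsNoetherian (WeylAlgebra k n) N] (a : Fin n → ℤ) :
    FiniteDimensional k (wt k n N a) := by
  have hwf : WellFoundedGT (Submodule (WeylAlgebra k n) N) := isNoetherian_iff'.mp h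
  let f : Submodule k (wt k n N a) → Submodule (WeylAlgebra k n) N := fun W =>
    Submodule.span _ (W.map (wt k n N a).subtype : Set N)
  have hf : StrictMono f := by
    refine Monotone.strictMono_of_injective
      (fun W W' hW => Submodule.span_mono (Submodule.map_mono hW)) ?_
    -- Projecting `A W'` to weight `a` gives back `W'`, so ascending chains of subspaces embed in
    -- ascending chains of submodules.
    have key : ∀ W W', f W ≤ f W' → W ≤ W' := by
      intro W W' hW w hw
      have h1 : (w : N) ∈ f W' := hW (Submodule.subset_span ⟨w, hw, rfl⟩)
      have h2 := wtProj_span_mem hN (Submodule.map_subtype_le _ _) h1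
      rw [wtProj_apply hN w.2, if_pos rfl] at h2
      obtain ⟨w', hw', e⟩ := h2
      exact Subtype.ext e ▸ hw'
    exact fun W W' hW => le_antisymm (key _ _ hW.le) (key _ _ hW.ge)
  have : IsNoetherian k (wt k n N a) := isNoetherian_iff'.mpr hf.wellFoundedGT
  infer_instance

end FiniteDimensional

/-! ### Multiplicities and minimal primes for an arbitrary good filtration -/

section GoodFiltration

variable {k : Type*} [Field k] [CharZero k] {n : ℕ} {N : Type*} [AddCommGroup N] [Module k N]
    [Module (WeylAlgebra k n) N] [IsScalarTower k (WeylAlgebra k n) N]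
    (hN : ⨆ a, wt k n N a = ⊤)
    [∀ F : Finset (Fin n), FiniteDimensional k (wt k n N (shiftVec F))]
    {G : ModFiltration k n N}

namespace ModFiltration

include hN

theorem IsGood.multiplicity_eq_sum (hG : G.IsGood) (Q : Ideal (WeylAlgebra.Gr k n)) [Q.IsPrime] :
    G.multiplicity Q =
      ∑ s : BasisIndex k n N, Module.localLength Q (WeylAlgebra.Gr k n ⧸ idealQ k n s.1) := by
  rw [hG.multiplicity_eq Q (canon_isGood hN), multiplicity_eq_localLength,
    ← (structEquiv hN).localLength_eq Q, Module.localLength_pi]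

/-- Containing the annihilator means lying in the support, that is, having nonzero multiplicity, and
this can be computed from the canonical filtration. -/
theorem IsGood.annihilator_le_iff (hG : G.IsGood) (Q : Ideal (WeylAlgebra.Gr k n)) [Q.IsPrime] :
    Module.annihilator (WeylAlgebra.Gr k n) G.Gr ≤ Q ↔
      ∃ F, wt k n N (shiftVec F) ≠ ⊥ ∧ idealQ k n F ≤ Q := by
  have : Module.Finite (WeylAlgebra.Gr k n) G.Gr := hG
  have h1 : Module.annihilator (WeylAlgebra.Gr k n) G.Gr ≤ Q ↔ G.multiplicity Q ≠ 0 := by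
    rw [multiplicity_eq_localLength, Module.localLength_ne_zero_iff, Module.support_eq_zeroLocus]
    rfl
  rw [h1, hG.multiplicity_eq_sum hN, ne_eq, Finset.sum_eq_zero_iff]
  push Not
  simp only [Finset.mem_univ, true_and, Module.localLength_quotient_ne_zero_iff]
  constructor
  · rintro ⟨⟨F, j⟩, hs⟩
    refine ⟨F, fun h => ?_, hs⟩
    have : Module.finrank k (wt k n N (shiftVec F)) = 0 := Submodule.finrank_eq_zero.mpr h
    exact (Fin.cast this j).elim0
  · rintro ⟨F, hF, hs⟩
    have : 0 < Module.finrank k (wt k n N (shiftVec F)) :=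
      Nat.pos_of_ne_zero fun h => hF (Submodule.finrank_eq_zero.mp h)
    exact ⟨⟨F, ⟨0, this⟩⟩, hs⟩

/-- The primes over the annihilator are those containing some `Q_F` with nonzero weight space. As
these `Q_F` are prime and incomparable, they are exactly the minimal ones. -/
theorem IsGood.SS_eq (hG : G.IsGood) :
    G.SS = {Q | ∃ F : Finset (Fin n), Q = idealQ k n F ∧ wt k n N (shiftVec F) ≠ ⊥} := by
  have : Module.Finite (WeylAlgebra.Gr k n) G.Gr := hG
  ext Q
  have hmin : ∀ F, wt k n N (shiftVec F) ≠ ⊥ →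
      idealQ k n F ∈ (Module.annihilator (WeylAlgebra.Gr k n) G.Gr).minimalPrimes := by
    intro F hF
    have := idealQ_isPrime k F
    refine ⟨⟨this, (hG.annihilator_le_iff hN _).mpr ⟨F, hF, le_rfl⟩⟩, fun P hP hPF => ?_⟩
    have := hP.1
    obtain ⟨F', -, hF'⟩ := (hG.annihilator_le_iff hN P).mp hP.2
    rwa [← eq_of_idealQ_le (hF'.trans hPF)]
  refine Module.minimal_associatedPrimes_iff.trans ⟨fun h => ?_, ?_⟩
  · have := h.1.1
    obtain ⟨F, hF, hFQ⟩ := (hG.annihilator_le_iff hN Q).mp h.1.2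
    exact ⟨F, le_antisymm (h.2 (hmin F hF).1 hFQ) hFQ, hF⟩
  · rintro ⟨F, rfl, hF⟩
    exact hmin F hF

/-- A summand `gr A / Q_{F'}` with `F' ≠ F` dies at `Q_F` by incomparability, and each copy of `gr A
/ Q_F` contributes one. -/
theorem IsGood.multiplicity_idealQ (hG : G.IsGood) (F : Finset (Fin n))
    [(idealQ k n F).IsPrime] :
    G.multiplicity (idealQ k n F) = (Module.finrank k (wt k n N (shiftVec F)) : ℕ∞) := by
  rw [hG.multiplicity_eq_sum hN, ← Finset.univ_sigma_univ, Finset.sum_sigma,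
    Finset.sum_eq_single F]
  · simp [Module.localLength_quotient_self]
  · intro F' _ hF'
    refine Finset.sum_eq_zero fun j _ => ?_
    by_contra h
    exact hF' (eq_of_idealQ_le ((Module.localLength_quotient_ne_zero_iff _ _).mp h))
  · simp

end ModFiltration

end GoodFiltration

end WeylAlgebra

end
theorem proposition5p6 (k : Type*) [Field k] [CharZero k] (n : ℕ) (M : Type*) [AddCommGroup M]
    [Module k M] [Module (WeylAlgebra k n) M] [IsScalarTower k (WeylAlgebra k n) M]
    [Module.Finite (WeylAlgebra k n) M] :
    (∃ G : WeylAlgebra.ModFiltration k n (WeylAlgebra.rat k n M), G.IsGood) ∧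
    ∀ G : WeylAlgebra.ModFiltration k n (WeylAlgebra.rat k n M), G.IsGood →
      G.SS = {Q | ∃ F : Finset (Fin n),
        Q = WeylAlgebra.idealQ k n F ∧ WeylAlgebra.wt k n M (WeylAlgebra.shiftVec F) ≠ ⊥} ∧
      ∀ F : Finset (Fin n), ∃ _ : (WeylAlgebra.idealQ k n F).IsPrime,
        FiniteDimensional k (WeylAlgebra.wt k n M (WeylAlgebra.shiftVec F)) ∧
        G.multiplicity (WeylAlgebra.idealQ k n F) =
          (Module.finrank k (WeylAlgebra.wt k n M (WeylAlgebra.shiftVec F)) : ℕ∞) := by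
  have hM := WeylAlgebra.isNoetherian_of_finite k n M
  have hN := WeylAlgebra.iSup_wt_rat k n M
  -- `M_rat` is noetherian as a submodule of the noetherian module `M`.
  have hfin := WeylAlgebra.finiteDimensional_wt hN
  have hbot : ∀ a, WeylAlgebra.wt k n (WeylAlgebra.rat k n M) a ≠ ⊥ ↔
      WeylAlgebra.wt k n M a ≠ ⊥ := fun a => by
    rw [← Submodule.nontrivial_iff_ne_bot, ← Submodule.nontrivial_iff_ne_bot]
    exact (WeylAlgebra.wtRatEquiv k n M a).toEquiv.nontrivial_congr
  refine ⟨⟨_, WeylAlgebra.canon_isGood hN⟩, fun G hG => ⟨?_, fun F =>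
    ⟨WeylAlgebra.idealQ_isPrime k F, (WeylAlgebra.wtRatEquiv k n M _).finiteDimensional, ?_⟩⟩⟩
  · rw [hG.SS_eq hN]
    simp only [hbot]
  · have := WeylAlgebra.idealQ_isPrime k F
    rw [hG.multiplicity_idealQ hN, (WeylAlgebra.wtRatEquiv k n M _).finrank_eq]
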